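/- Let $\mathcal{Z}(\mathbb{R}^d)$ be the Lizorkin space of all $\varphi\in\mathcal{S}(\mathbb{R}^d)$ (complex-valued Schwartz functions) with $\int_{\mathbb{R}^d}x^{\alpha}\varphi(x)\,dx=0$ for every $\alpha\in\mathbb{N}_0^d$, with the topology of $\mathcal{S}(\mathbb{R}^d)$, and let $\mathcal{Z}'(\mathbb{R}^d)$ be the space of continuous linear functionals on it. With $\hat\varphi(\xi)=\int_{\mathbb{R}^d} e^{-ix\cdot\xi}\varphi(x)\,dx$, the logarithmic Laplacian $\log(-\Delta):\mathcal{Z}(\mathbb{R}^d)\to\mathcal{Z}(\mathbb{R}^d)$ is given by $\widehat{\log(-\Delta)\varphi}(\xi)=\log(|\xi|^2)\,\hat\varphi(\xi)$ for $\xi\neq 0$, and it is extended to $\mathcal{Z}'(\mathbb{R}^d)$ by $\langle\log(-\Delta)u,\varphi\rangle=\langle u,\log(-\Delta)\varphi\rangle$. A fundamental solution of the logarithmic Laplacian is an $E\in\mathcal{Z}'(\mathbb{R}^d)$ with $\log(-\Delta)E=\delta_0$ in $\mathcal{Z}'(\mathbb{R}^d)$, that is, $\langle E,\log(-\Delta)\varphi\rangle=\varphi(0)$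 for all $\varphi\in\mathcal{Z}(\mathbb{R}^d)$. An element of $\mathcal{Z}'(\mathbb{R}^d)$ is identified with its extension to a tempered distribution whose Fourier transform is a locally integrable function in a neighbourhood of $0$, if there is one (it is then unique). \textbf{Theorem.} Let $d\in\{1,2\}$. There is a fundamental solution $E$ of the logarithmic Laplacian on $\mathbb{R}^d$ that has such a tempered extension, and this extension is, on $\{|x|\ge 2\}$, a radial locally integrable function (that is, it acts on the functions in $C_c^\infty(\mathbb{R}^d)$ supported in $\{|x|\ge 2\}$ by integration against that function), which satisfies, for some constant $C$, $$|E(x)|\le C\,|x|^{-\frac{d-1}{2}}\qquad\text{for all } |x|\ge 2 .$$ -/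

import Mathlib

open MeasureTheory Filter
open scoped SchwartzMap FourierTransform Topology ContDiff

namespace LogLap

/-- The space `Ψ(ℝᵈ)` of Schwartz functions all of whose derivatives, of every order, vanish at
the origin. -/
def flatSpace (d : ℕ) : Submodule ℂ 𝓢(EuclideanSpace ℝ (Fin d), ℂ) where
  carrier := {ψ | ∀ n : ℕ, iteratedFDeriv ℝ n ψ 0 = 0}
  add_mem' {f g} hf hg n := by
    have := iteratedFDeriv_add_apply (𝕜 := ℝ) (i := n) (x := (0 : EuclideanSpace ℝ (Fin d)))
      ((f.smooth n).contDiffAt) ((g.smooth n).contDiffAt)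
    simp only [hf n, hg n, add_zero] at this
    exact this
  zero_mem' n := by
    have : (⇑(0 : 𝓢(EuclideanSpace ℝ (Fin d), ℂ))) = fun _ => (0 : ℂ) := rfl
    rw [this, iteratedFDeriv_fun_zero]; rfl
  smul_mem' c f hf n := by
    have := iteratedFDeriv_const_smul_apply (𝕜 := ℝ) (i := n) (a := c)
      (x := (0 : EuclideanSpace ℝ (Fin d))) ((f.smooth n).contDiffAt)
    simp only [hf n, smul_zero] at this
    exact this

/-- The symbol `log |2πξ|²` of the logarithmic Laplacian. Mathlib's Fourier transform has the kernel
`exp (-2πi⟨x, ξ⟩)`, so that `-Δ` has the symbol `|2πξ|²`. -/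
noncomputable def logSymbol {d : ℕ} (ξ : EuclideanSpace ℝ (Fin d)) : ℝ :=
  Real.log (‖(2 * Real.pi) • ξ‖ ^ 2)

lemma norm_iteratedFDeriv_log_le (n : ℕ) {y : ℝ} (hy : 0 < y) :
    ‖iteratedFDeriv ℝ n Real.log y‖ ≤ n.factorial * (1 + y + y⁻¹) ^ (n + 1) := by
  have hyi : 0 < y⁻¹ := inv_pos.2 hy
  rw [norm_iteratedFDeriv_eq_norm_iteratedDeriv]
  cases n with
  | zero =>
    simp only [iteratedDeriv_zero, Nat.factorial_zero, Nat.cast_one, one_mul, zero_add, pow_one,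
      Real.norm_eq_abs, abs_le]
    have h1 := Real.log_le_sub_one_of_pos hy
    have h2 := Real.log_le_sub_one_of_pos hyi
    rw [Real.log_inv] at h2
    constructor <;> linarith
  | succ n =>
    rw [iteratedDeriv_succ', Real.deriv_log', iteratedDeriv_eq_iterate]
    have := iter_deriv_inv (𝕜 := ℝ) n y
    rw [this]
    have e : y ^ (-1 - n : ℤ) = (y⁻¹) ^ (n + 1) := by
      rw [inv_pow, ← zpow_natCast, ← zpow_neg]; congr 1; push_cast; ring
    rw [e, norm_mul, norm_mul, norm_pow, norm_neg, norm_one, one_pow, one_mul,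
      Real.norm_of_nonneg (by positivity), Real.norm_of_nonneg (by positivity)]
    have h1 : (n.factorial : ℝ) ≤ (n + 1).factorial := by
      exact_mod_cast Nat.factorial_le (Nat.le_succ n)
    have h2 : y⁻¹ ^ (n + 1) ≤ (1 + y + y⁻¹) ^ (n + 1) := by gcongr; linarith
    have h3 : (1 + y + y⁻¹) ^ (n + 1) ≤ (1 + y + y⁻¹) ^ (n + 1 + 1) := by
      apply pow_le_pow_right₀ <;> [linarith; omega]
    exact mul_le_mul h1 (h2.trans h3) (by positivity) (by positivity)

lemma contDiffOn_logSymbol {d : ℕ} : ContDiffOn ℝ ∞ (logSymbol (d := d)) {0}ᶜ := by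
  apply ContDiffOn.log
  · exact ((contDiff_const_smul _).norm_sq ℝ).contDiffOn
  · intro x hx
    have : x ≠ 0 := hx
    have := Real.pi_pos
    simp_all [this.ne']

lemma norm_iteratedFDeriv_logSymbol_le (d n : ℕ) : ∃ (M : ℕ) (C : ℝ), 0 ≤ C ∧
    ∀ ξ : EuclideanSpace ℝ (Fin d), ξ ≠ 0 →
      ‖iteratedFDeriv ℝ n (logSymbol (d := d)) ξ‖ ≤ C * (‖ξ‖ + ‖ξ‖⁻¹) ^ M := by
  have hq : Function.HasTemperateGrowth
      (fun ξ : EuclideanSpace ℝ (Fin d) => ‖(2 * Real.pi) • ξ‖ ^ 2) :=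
    (Function.hasTemperateGrowth_norm_sq (H := EuclideanSpace ℝ (Fin d))).comp
      (((2 * Real.pi) • ContinuousLinearMap.id ℝ
        (EuclideanSpace ℝ (Fin d))).hasTemperateGrowth)
  obtain ⟨k, A, hA, hb⟩ := hq.norm_iteratedFDeriv_le_uniform n
  set B : ℝ := (2 * Real.pi) ^ 2 with hB
  have hB1 : 1 ≤ B := by have := Real.pi_gt_three; nlinarith
  refine ⟨2 * (n + 1) + k * n, n.factorial * (n.factorial * (3 * B) ^ (n + 1)) *
    ((1 + A) * 2 ^ k) ^ n, by positivity, fun ξ hξ => ?_⟩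
  have hr : 0 < ‖ξ‖ := norm_pos_iff.2 hξ
  set r := ‖ξ‖ with hrdef
  have hri : 0 < r⁻¹ := inv_pos.2 hr
  set w := r + r⁻¹ with hw
  have hmul : r * r⁻¹ = 1 := mul_inv_cancel₀ hr.ne'
  have hw1 : 1 ≤ w := by nlinarith [sq_nonneg (r - 1), sq_nonneg (r⁻¹ - 1)]
  have hopen : IsOpen ({0}ᶜ : Set (EuclideanSpace ℝ (Fin d))) := isOpen_compl_singleton
  have hy : ‖(2 * Real.pi) • ξ‖ ^ 2 = B * r ^ 2 := by
    rw [norm_smul, Real.norm_of_nonneg (by positivity), mul_pow]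
  have hypos : 0 < B * r ^ 2 := by positivity
  have hyw : 1 + B * r ^ 2 + (B * r ^ 2)⁻¹ ≤ 3 * B * w ^ 2 := by
    have h1 : (B * r ^ 2)⁻¹ ≤ r⁻¹ ^ 2 := by
      rw [mul_inv, inv_pow]
      exact mul_le_of_le_one_left (by positivity) (inv_le_one_of_one_le₀ hB1)
    have h2 : w ^ 2 = r ^ 2 + 2 + r⁻¹ ^ 2 := by rw [hw]; nlinarith
    rw [h2]
    have : 0 < r ^ 2 := by positivity
    have : 0 < r⁻¹ ^ 2 := by positivity
    nlinarith
  have key := norm_iteratedFDerivWithin_comp_le (𝕜 := ℝ) (n := n) (N := ∞) (x := ξ)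
    (s := ({0}ᶜ : Set (EuclideanSpace ℝ (Fin d)))) (t := Set.Ioi (0 : ℝ)) (g := Real.log)
    (f := fun ξ : EuclideanSpace ℝ (Fin d) => ‖(2 * Real.pi) • ξ‖ ^ 2)
    (C := n.factorial * (3 * B * w ^ 2) ^ (n + 1)) (D := (1 + A) * (2 * w) ^ k)
    (Real.contDiffOn_log.mono (fun y hy => (ne_of_gt hy : y ≠ 0)))
    hq.1.contDiffOn (by exact_mod_cast le_top) (isOpen_Ioi.uniqueDiffOn) hopen.uniqueDiffOn
    (by
      intro x hx
      have : x ≠ 0 := hx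
      have hp := Real.pi_pos.ne'
      simp only [Set.mem_Ioi]
      have : (2 * Real.pi) • x ≠ 0 := by simp [this, hp]
      positivity) hξ
    (by
      intro i hi
      rw [iteratedFDerivWithin_of_isOpen i isOpen_Ioi (by simpa only [hy, Set.mem_Ioi] using hypos)]
      simp only [hy]
      refine (norm_iteratedFDeriv_log_le i hypos).trans ?_
      have h1 : (i.factorial : ℝ) ≤ n.factorial := by exact_mod_cast Nat.factorial_le hi
      have h2 : (1 + B * r ^ 2 + (B * r ^ 2)⁻¹) ^ (i + 1) ≤ (3 * B * w ^ 2) ^ (n + 1) := by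
        have hge : 1 ≤ 1 + B * r ^ 2 + (B * r ^ 2)⁻¹ := by
          have := inv_pos.2 hypos
          linarith
        calc _ ≤ (3 * B * w ^ 2) ^ (i + 1) := by gcongr
          _ ≤ _ := pow_le_pow_right₀ (hge.trans hyw) (by omega)
      exact mul_le_mul h1 h2 (by positivity) (by positivity))
    (by
      intro i hi1 hin
      rw [iteratedFDerivWithin_of_isOpen i hopen hξ]
      have h1 : A * (1 + r) ^ k ≤ (1 + A) * (2 * w) ^ k := by
        gcongr
        · linarith
        · linarith
      have h2 : 1 ≤ (1 + A) * (2 * w) ^ k :=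
        one_le_mul_of_one_le_of_one_le (by linarith) (one_le_pow₀ (by linarith))
      exact ((hb i hin ξ).trans h1).trans (le_self_pow₀ h2 (by omega)))
  rw [iteratedFDerivWithin_of_isOpen n hopen hξ] at key
  refine key.trans (le_of_eq ?_)
  simp only [mul_pow]
  ring_nf

/-- Taylor's inequality at the origin for functions that vanish there to infinite order. -/
lemma norm_iteratedFDeriv_le_of_flat {d : ℕ} {f : 𝓢(EuclideanSpace ℝ (Fin d), ℂ)}
    (hf : f ∈ flatSpace d) (M n : ℕ) (ξ : EuclideanSpace ℝ (Fin d)) :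
    ‖iteratedFDeriv ℝ n f ξ‖ ≤ SchwartzMap.seminorm ℂ 0 (n + M) f * ‖ξ‖ ^ M := by
  induction M generalizing n ξ with
  | zero => simpa using f.norm_iteratedFDeriv_le_seminorm ℂ n ξ
  | succ M ih =>
    have := Convex.norm_image_sub_le_of_norm_fderiv_le (𝕜 := ℝ) (f := iteratedFDeriv ℝ n f)
      (C := SchwartzMap.seminorm ℂ 0 (n + (M + 1)) f * ‖ξ‖ ^ M)
      (s := Metric.closedBall 0 ‖ξ‖) (x := 0) (y := ξ)
      (fun x _ => ((f.smooth ⊤).differentiable_iteratedFDeriv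
        (by exact_mod_cast WithTop.coe_lt_top n)) x)
      (fun x hx => by
        rw [norm_fderiv_iteratedFDeriv]
        refine (ih (n + 1) x).trans ?_
        rw [show n + 1 + M = n + (M + 1) by ring]
        have : ‖x‖ ≤ ‖ξ‖ := by simpa using hx
        gcongr)
      (convex_closedBall _ _) (by simp) (by simp)
    rw [hf n, sub_zero, sub_zero] at this
    rw [pow_succ, ← mul_assoc]
    exact this

lemma logMul_bound (d k n m : ℕ) : ∃ (s : Finset (ℕ × ℕ)) (C : ℝ), 0 ≤ C ∧
    ∀ f ∈ flatSpace d, ∀ ξ : EuclideanSpace ℝ (Fin d), ξ ≠ 0 →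
      ‖ξ‖ ^ k * ‖iteratedFDeriv ℝ n (fun ξ => logSymbol ξ • f ξ) ξ‖ ≤
        C * s.sup (schwartzSeminormFamily ℂ (EuclideanSpace ℝ (Fin d)) ℂ) f * min 1 (‖ξ‖ ^ m) := by
  choose M C hC hb using norm_iteratedFDeriv_logSymbol_le d
  let N : ℕ := ∑ i ∈ Finset.range (n + 1), M i
  let A : ℝ := ∑ i ∈ Finset.range (n + 1), (n.choose i : ℝ) * C i * 2 ^ M i
  let s : Finset (ℕ × ℕ) := Finset.range (k + N + 1) ×ˢ Finset.range (n + (N + m) + 1)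
  refine ⟨s, A, Finset.sum_nonneg fun i _ => by have := hC i; positivity, fun f hf ξ hξ => ?_⟩
  have hr : 0 < ‖ξ‖ := norm_pos_iff.2 hξ
  set P := s.sup (schwartzSeminormFamily ℂ (EuclideanSpace ℝ (Fin d)) ℂ) f with hP
  have hle : ∀ a b : ℕ, a ≤ k + N → b ≤ n + (N + m) → SchwartzMap.seminorm ℂ a b f ≤ P := by
    intro a b ha hb
    have : (a, b) ∈ s := by simp [s]; omega
    exact Seminorm.le_def.mp
      (Finset.le_sup (f := schwartzSeminormFamily ℂ (EuclideanSpace ℝ (Fin d)) ℂ) this) f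
  have hP0 : 0 ≤ P := apply_nonneg _ _
  have hopen : IsOpen ({0}ᶜ : Set (EuclideanSpace ℝ (Fin d))) := isOpen_compl_singleton
  have key := norm_iteratedFDerivWithin_smul_le (𝕜 := ℝ) (N := ∞) (n := n)
    (contDiffOn_logSymbol (d := d)) (f.smooth ⊤).contDiffOn hopen.uniqueDiffOn
    (show ξ ∈ ({0}ᶜ : Set (EuclideanSpace ℝ (Fin d))) from hξ) (by exact_mod_cast le_top)
  simp only [iteratedFDerivWithin_of_isOpen _ hopen
    (show ξ ∈ ({0}ᶜ : Set (EuclideanSpace ℝ (Fin d))) from hξ)] at key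
  have hmain : ∀ i ∈ Finset.range (n + 1),
      ‖ξ‖ ^ k * ((‖ξ‖ + ‖ξ‖⁻¹) ^ M i * ‖iteratedFDeriv ℝ (n - i) f ξ‖) ≤
        2 ^ M i * (P * min 1 (‖ξ‖ ^ m)) := by
    intro i hi
    have hMN : M i ≤ N := Finset.single_le_sum (f := M) (fun _ _ => Nat.zero_le _) hi
    rcases le_total ‖ξ‖ 1 with h | h
    · have h1 : ‖ξ‖ + ‖ξ‖⁻¹ ≤ 2 * ‖ξ‖⁻¹ := by
        have := (one_le_inv₀ hr).2 h
        linarith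
      have h2 := norm_iteratedFDeriv_le_of_flat hf (M i + m) (n - i) ξ
      have h3 : SchwartzMap.seminorm ℂ 0 (n - i + (M i + m)) f ≤ P := hle _ _ (by omega) (by omega)
      rw [min_eq_right (pow_le_one₀ hr.le h)]
      calc ‖ξ‖ ^ k * ((‖ξ‖ + ‖ξ‖⁻¹) ^ M i * ‖iteratedFDeriv ℝ (n - i) f ξ‖)
          ≤ 1 * ((2 * ‖ξ‖⁻¹) ^ M i * (P * ‖ξ‖ ^ (M i + m))) := by
            gcongr
            · exact pow_le_one₀ hr.le h
            · exact h2.trans (by gcongr)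
        _ = _ := by
            rw [mul_pow, pow_add, inv_pow]; field_simp
    · have h1 : ‖ξ‖ + ‖ξ‖⁻¹ ≤ 2 * ‖ξ‖ := by
        have := inv_le_one_of_one_le₀ h
        linarith
      have h2 := f.le_seminorm ℂ (k + M i) (n - i) ξ
      have h3 : SchwartzMap.seminorm ℂ (k + M i) (n - i) f ≤ P := hle _ _ (by omega) (by omega)
      rw [min_eq_left (one_le_pow₀ h), mul_one]
      calc ‖ξ‖ ^ k * ((‖ξ‖ + ‖ξ‖⁻¹) ^ M i * ‖iteratedFDeriv ℝ (n - i) f ξ‖)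
          ≤ ‖ξ‖ ^ k * ((2 * ‖ξ‖) ^ M i * ‖iteratedFDeriv ℝ (n - i) f ξ‖) := by gcongr
        _ = 2 ^ M i * (‖ξ‖ ^ (k + M i) * ‖iteratedFDeriv ℝ (n - i) f ξ‖) := by
            rw [mul_pow, pow_add]; ring
        _ ≤ _ := by gcongr; exact h2.trans h3
  calc _ ≤ ‖ξ‖ ^ k * ∑ i ∈ Finset.range (n + 1), (n.choose i : ℝ) *
        ‖iteratedFDeriv ℝ i (logSymbol (d := d)) ξ‖ * ‖iteratedFDeriv ℝ (n - i) f ξ‖ := by gcongr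
    _ ≤ ∑ i ∈ Finset.range (n + 1), (n.choose i : ℝ) * C i * 2 ^ M i *
        (P * min 1 (‖ξ‖ ^ m)) := by
        rw [Finset.mul_sum]
        refine Finset.sum_le_sum fun i hi => ?_
        calc _ ≤ ‖ξ‖ ^ k * ((n.choose i : ℝ) * (C i * (‖ξ‖ + ‖ξ‖⁻¹) ^ M i) *
              ‖iteratedFDeriv ℝ (n - i) f ξ‖) := by
              gcongr
              exact hb i ξ hξ
          _ = (n.choose i : ℝ) * C i *
              (‖ξ‖ ^ k * ((‖ξ‖ + ‖ξ‖⁻¹) ^ M i * ‖iteratedFDeriv ℝ (n - i) f ξ‖)) := by ring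
          _ ≤ (n.choose i : ℝ) * C i * (2 ^ M i * (P * min 1 (‖ξ‖ ^ m))) := by
              exact mul_le_mul_of_nonneg_left (hmain i hi) (mul_nonneg (by positivity) (hC i))
          _ = _ := by ring
    _ = _ := by rw [← Finset.sum_mul, mul_assoc]

lemma logMul_flat {d : ℕ} {f : 𝓢(EuclideanSpace ℝ (Fin d), ℂ)} (hf : f ∈ flatSpace d) (n : ℕ) :
    iteratedFDeriv ℝ n (fun ξ => logSymbol ξ • f ξ) 0 = 0 ∧
      HasFDerivAt (𝕜 := ℝ) (iteratedFDeriv ℝ n (fun ξ => logSymbol ξ • f ξ)) 0 0 := by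
  have step : ∀ n, iteratedFDeriv ℝ n (fun ξ => logSymbol ξ • f ξ) 0 = 0 →
      HasFDerivAt (𝕜 := ℝ) (iteratedFDeriv ℝ n (fun ξ => logSymbol ξ • f ξ)) 0 0 := by
    intro n h0
    obtain ⟨s, C, hC, hb⟩ := logMul_bound d 0 n 2
    set K := C * s.sup (schwartzSeminormFamily ℂ (EuclideanSpace ℝ (Fin d)) ℂ) f
    have hK : 0 ≤ K := mul_nonneg hC (apply_nonneg _ _)
    apply HasFDerivAt.of_isLittleO
    have hO : (fun x : EuclideanSpace ℝ (Fin d) =>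
        iteratedFDeriv ℝ n (fun ξ => logSymbol ξ • f ξ) x) =O[𝓝 0] fun x => ‖x‖ ^ 2 := by
      refine Asymptotics.IsBigO.of_bound K (Eventually.of_forall fun x => ?_)
      by_cases hx : x = 0
      · subst hx; rw [h0]; simp
      · have := hb f hf x hx
        rw [pow_zero, one_mul] at this
        refine this.trans ?_
        rw [Real.norm_of_nonneg (by positivity)]
        exact mul_le_mul_of_nonneg_left (min_le_right _ _) hK
    have := hO.trans_isLittleO (Asymptotics.isLittleO_norm_pow_id one_lt_two)
    simpa only [h0, sub_zero, zero_apply] using this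
  have main : ∀ n, iteratedFDeriv ℝ n (fun ξ => logSymbol ξ • f ξ) 0 = 0 := by
    intro n
    induction n with
    | zero =>
      ext m
      have : f 0 = 0 := by
        have := congrArg (fun g => g (fun _ => 0)) (hf 0)
        simpa using this
      simp [this]
    | succ n ih =>
      rw [iteratedFDeriv_succ_eq_comp_left, Function.comp_apply, (step n ih).fderiv]
      exact LinearIsometryEquiv.map_zero _
  exact ⟨main n, step n (main n)⟩

lemma contDiff_logMul {d : ℕ} {f : 𝓢(EuclideanSpace ℝ (Fin d), ℂ)} (hf : f ∈ flatSpace d) :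
    ContDiff ℝ ∞ (fun ξ => logSymbol ξ • f ξ) := by
  apply contDiff_of_differentiable_iteratedFDeriv
  intro n _ x
  by_cases hx : x = 0
  · subst hx; exact (logMul_flat hf n).2.differentiableAt
  · have h : ContDiffAt ℝ ∞ (fun ξ => logSymbol ξ • f ξ) x :=
      (contDiffOn_logSymbol.contDiffAt (isOpen_compl_singleton.mem_nhds hx)).smul
        (f.smooth ⊤).contDiffAt
    exact h.differentiableAt_iteratedFDeriv (by exact_mod_cast WithTop.coe_lt_top n)

lemma logMul_decay (d k n : ℕ) : ∃ (s : Finset (ℕ × ℕ)) (C : ℝ), 0 ≤ C ∧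
    ∀ f ∈ flatSpace d, ∀ ξ : EuclideanSpace ℝ (Fin d),
      ‖ξ‖ ^ k * ‖iteratedFDeriv ℝ n (fun ξ => logSymbol ξ • f ξ) ξ‖ ≤
        C * s.sup (schwartzSeminormFamily ℂ (EuclideanSpace ℝ (Fin d)) ℂ) f := by
  obtain ⟨s, C, hC, h⟩ := logMul_bound d k n 0
  refine ⟨s, C, hC, fun f hf ξ => ?_⟩
  by_cases hξ : ξ = 0
  · subst hξ
    rw [(logMul_flat hf n).1, norm_zero, norm_zero, mul_zero]
    exact mul_nonneg hC (apply_nonneg _ _)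
  · simpa using h f hf ξ hξ

/-- Multiplication by the symbol `log |2πξ|²`, from `Ψ(ℝᵈ)` to the Schwartz space. -/
noncomputable def logMulLM (d : ℕ) : flatSpace d →ₗ[ℂ] 𝓢(EuclideanSpace ℝ (Fin d), ℂ) where
  toFun ψ :=
    { toFun := fun ξ => logSymbol ξ • (ψ : 𝓢(EuclideanSpace ℝ (Fin d), ℂ)) ξ
      smooth' := contDiff_logMul ψ.2
      decay' := fun k n => by
        obtain ⟨s, C, _, h⟩ := logMul_decay d k n
        exact ⟨_, h ψ ψ.2⟩ }
  map_add' f g := by ext ξ; exact smul_add _ _ _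
  map_smul' c f := by
    ext ξ
    exact smul_comm (logSymbol ξ) c ((f : 𝓢(EuclideanSpace ℝ (Fin d), ℂ)) ξ)

lemma continuous_logMulLM (d : ℕ) : Continuous (logMulLM d) := by
  refine WithSeminorms.continuous_of_isBounded
    (LinearMap.withSeminorms_induced (schwartz_withSeminorms ℂ (EuclideanSpace ℝ (Fin d)) ℂ)
      (flatSpace d).subtype)
    (schwartz_withSeminorms ℂ (EuclideanSpace ℝ (Fin d)) ℂ) (logMulLM d) fun n => ?_
  obtain ⟨s, C, hC, h⟩ := logMul_decay d n.1 n.2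
  refine ⟨s, ⟨C, hC⟩, fun f => ?_⟩
  rw [← SeminormFamily.finset_sup_comp]
  exact (logMulLM d f).seminorm_le_bound ℂ n.1 n.2 (mul_nonneg hC (apply_nonneg _ _)) (h f f.2)

/-- Multiplication by the symbol `log |2πξ|²`, as a continuous linear operator of `Ψ(ℝᵈ)`. -/
noncomputable def logMul (d : ℕ) : flatSpace d →L[ℂ] flatSpace d :=
  ContinuousLinearMap.codRestrict ⟨logMulLM d, continuous_logMulLM d⟩ (flatSpace d)
    fun ψ n => (logMul_flat ψ.2 n).1

lemma integrable_monomial_mul {d : ℕ} (α : Fin d → ℕ) (φ : 𝓢(EuclideanSpace ℝ (Fin d), ℂ)) :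
    Integrable fun x : EuclideanSpace ℝ (Fin d) => ((∏ i, x i ^ α i : ℝ) : ℂ) * φ x := by
  refine (φ.integrable_pow_mul volume (∑ i, α i)).mono' (by fun_prop) (Eventually.of_forall ?_)
  intro x
  rw [norm_mul, Complex.norm_real, norm_prod, ← Finset.prod_pow_eq_pow_sum]
  gcongr with i
  rw [norm_pow]
  gcongr
  exact PiLp.norm_apply_le x i

/-- The Lizorkin space `Z(ℝᵈ)`: the Schwartz functions all of whose moments
`∫ x^α φ(x) dx` vanish, with the topology of the Schwartz space. -/
def lizorkinSpace (d : ℕ) : Submodule ℂ 𝓢(EuclideanSpace ℝ (Fin d), ℂ) where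
  carrier := {φ | ∀ α : Fin d → ℕ,
    ∫ x : EuclideanSpace ℝ (Fin d), ((∏ i, x i ^ α i : ℝ) : ℂ) * φ x = 0}
  add_mem' {f g} hf hg α := by
    simp only [add_apply, mul_add]
    rw [integral_add (integrable_monomial_mul α f) (integrable_monomial_mul α g), hf α, hg α,
      add_zero]
  zero_mem' α := by simp
  smul_mem' c f hf α := by
    simp only [smul_apply, smul_eq_mul, mul_left_comm _ c]
    rw [integral_const_mul, hf α, mul_zero]

lemma iteratedFDeriv_fourier_zero_apply {d : ℕ} (φ : 𝓢(EuclideanSpace ℝ (Fin d), ℂ)) (n : ℕ)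
    (m : Fin n → EuclideanSpace ℝ (Fin d)) :
    iteratedFDeriv ℝ n (𝓕 φ : 𝓢(EuclideanSpace ℝ (Fin d), ℂ)) 0 m = (-(2 * Real.pi * Complex.I)) ^ n *
      ∫ x : EuclideanSpace ℝ (Fin d), ((∏ j, inner ℝ x (m j) : ℝ) : ℂ) * φ x := by
  have hint : ∀ k : ℕ, Integrable fun v : EuclideanSpace ℝ (Fin d) => ‖v‖ ^ k * ‖φ v‖ :=
    fun k => φ.integrable_pow_mul volume k
  rw [SchwartzMap.fourier_coe, Real.iteratedFDeriv_fourier (N := ⊤) (fun k _ => hint k)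
    φ.continuous.aestronglyMeasurable le_top, Real.fourier_eq]
  simp only [inner_zero_right, neg_zero, AddChar.map_zero_eq_one, one_smul]
  rw [ContinuousMultilinearMap.integral_apply]
  · simp only [VectorFourier.fourierPowSMulRight_apply, smul_eq_mul, Complex.real_smul]
    rw [integral_const_mul]
    rfl
  · exact VectorFourier.integrable_fourierPowSMulRight _ (hint n)
      φ.continuous.aestronglyMeasurable

/-- A Schwartz function is in the Lizorkin space iff its Fourier transform is in `Ψ(ℝᵈ)`. -/
lemma fourier_mem_flatSpace_iff {d : ℕ} (φ : 𝓢(EuclideanSpace ℝ (Fin d), ℂ)) :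
    𝓕 φ ∈ flatSpace d ↔ φ ∈ lizorkinSpace d := by
  have hc : ∀ n : ℕ, (-(2 * Real.pi * Complex.I)) ^ n ≠ 0 := fun n => by
    simp [Real.pi_ne_zero]
  constructor
  · intro h α
    have := congrArg (fun g => g fun j => EuclideanSpace.single
      (finSigmaFinEquiv (n := α).symm j).1 (1 : ℝ)) (h (∑ i, α i))
    simp only [iteratedFDeriv_fourier_zero_apply, zero_apply,
      mul_eq_zero, hc, false_or] at this
    convert this using 5 with x
    rw [← Equiv.prod_comp finSigmaFinEquiv, Fintype.prod_sigma]
    simp [EuclideanSpace.inner_single_right]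
  · intro h n
    apply ContinuousMultilinearMap.toMultilinearMap_injective
    refine Module.Basis.ext_multilinear (fun _ => (EuclideanSpace.basisFun (Fin d) ℝ).toBasis)
      fun v => ?_
    change iteratedFDeriv ℝ n (𝓕 φ : 𝓢(EuclideanSpace ℝ (Fin d), ℂ)) 0 _ = 0
    rw [iteratedFDeriv_fourier_zero_apply]
    convert mul_zero _
    convert h (fun i => (Finset.univ.filter fun j => v j = i).card) using 5 with x
    calc _ = ∏ j, x (v j) := by simp [EuclideanSpace.inner_single_right]
      _ = _ := by
        rw [← Finset.prod_fiberwise' Finset.univ v (fun i => x i)]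
        simp only [Finset.prod_const]

/-- The logarithmic Laplacian on the Lizorkin space: `log(-Δ) φ = 𝓕⁻¹ (log |2πξ|² · 𝓕 φ)`. -/
noncomputable def logLaplacianLizorkin (d : ℕ) : lizorkinSpace d →L[ℂ] lizorkinSpace d :=
  ((FourierTransform.fourierInvCLM ℂ 𝓢(EuclideanSpace ℝ (Fin d), ℂ)).comp
    ((flatSpace d).subtypeL.comp ((logMul d).comp
      (((FourierTransform.fourierCLM ℂ 𝓢(EuclideanSpace ℝ (Fin d), ℂ)).comp
        (lizorkinSpace d).subtypeL).codRestrict (flatSpace d)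
          fun φ => (fourier_mem_flatSpace_iff _).2 φ.2)))).codRestrict (lizorkinSpace d)
    fun φ => by
      rw [← fourier_mem_flatSpace_iff]
      simp

/-- The logarithmic Laplacian is the Fourier multiplier with symbol `log |2πξ|²`. -/
lemma fourier_logLaplacianLizorkin {d : ℕ} (φ : lizorkinSpace d) (ξ : EuclideanSpace ℝ (Fin d)) :
    (𝓕 (logLaplacianLizorkin d φ : 𝓢(EuclideanSpace ℝ (Fin d), ℂ)) :
      𝓢(EuclideanSpace ℝ (Fin d), ℂ)) ξ =
      (Real.log (‖(2 * Real.pi) • ξ‖ ^ 2) : ℂ) *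
        (𝓕 (φ : 𝓢(EuclideanSpace ℝ (Fin d), ℂ)) : 𝓢(EuclideanSpace ℝ (Fin d), ℂ)) ξ := by
  change (𝓕 (𝓕⁻ (logMul d ⟨𝓕 (φ : 𝓢(EuclideanSpace ℝ (Fin d), ℂ)),
    (fourier_mem_flatSpace_iff _).2 φ.2⟩ : 𝓢(EuclideanSpace ℝ (Fin d), ℂ))) :
      𝓢(EuclideanSpace ℝ (Fin d), ℂ)) ξ = _
  rw [FourierTransform.fourier_fourierInv_eq]
  exact Complex.real_smul

/-- The Lizorkin distributions `Z'(ℝᵈ)`: continuous linear functionals on the Lizorkin space. -/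
abbrev LizorkinDistribution (d : ℕ) : Type := lizorkinSpace d →L[ℂ] ℂ

/-- The logarithmic Laplacian on Lizorkin distributions, `⟨log(-Δ) E, φ⟩ = ⟨E, log(-Δ) φ⟩`. -/
noncomputable def logLaplacian {d : ℕ} (E : LizorkinDistribution d) : LizorkinDistribution d :=
  E.comp (logLaplacianLizorkin d)

/-- The Dirac mass at the origin, as a Lizorkin distribution. -/
noncomputable def lizorkinDelta (d : ℕ) : LizorkinDistribution d :=
  ((BoundedContinuousFunction.evalCLM ℂ (0 : EuclideanSpace ℝ (Fin d))).comp
    (SchwartzMap.toBoundedContinuousFunctionCLM ℂ (EuclideanSpace ℝ (Fin d)) ℂ)).comp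
    (lizorkinSpace d).subtypeL

lemma lizorkinDelta_apply {d : ℕ} (φ : lizorkinSpace d) :
    lizorkinDelta d φ = (φ : 𝓢(EuclideanSpace ℝ (Fin d), ℂ)) 0 := rfl

/-- `E` is a fundamental solution of the logarithmic Laplacian: `log(-Δ) E = δ₀` in `Z'(ℝᵈ)`. -/
def IsFundamentalSolution {d : ℕ} (E : LizorkinDistribution d) : Prop :=
  logLaplacian E = lizorkinDelta d

/-- The tempered distribution `u` is, on the set `s`, the function `f`: the function is locally
integrable on `s`, and `u` acts by integration against `f` on the test functions supported in
`s`. -/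
def IsFunctionOn {d : ℕ} (u : 𝓢'(EuclideanSpace ℝ (Fin d), ℂ))
    (f : EuclideanSpace ℝ (Fin d) → ℂ) (s : Set (EuclideanSpace ℝ (Fin d))) : Prop :=
  LocallyIntegrableOn f s ∧
    ∀ φ : 𝓢(EuclideanSpace ℝ (Fin d), ℂ), HasCompactSupport φ → tsupport φ ⊆ s →
      u φ = ∫ x in s, f x * φ x

/-- `u` is the tempered distribution that represents the Lizorkin distribution `E`: it extends `E`,
and its Fourier transform is a locally integrable function in a neighbourhood of the origin. (Two
extensions of `E` differ by a polynomial, so the second condition makes `u` unique. It does not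
depend on the normalization of the Fourier transform.) -/
def IsRepresentative {d : ℕ} (u : 𝓢'(EuclideanSpace ℝ (Fin d), ℂ))
    (E : LizorkinDistribution d) : Prop :=
  (∀ φ : lizorkinSpace d, u (φ : 𝓢(EuclideanSpace ℝ (Fin d), ℂ)) = E φ) ∧
    ∃ r > 0, ∃ g : EuclideanSpace ℝ (Fin d) → ℂ, IsFunctionOn (𝓕 u) g (Metric.ball 0 r)

end LogLap

namespace LogLap

/-! ### Partial fractions for the reciprocal logarithm -/

section LogRepresentation

open Set

/-! A fundamental solution must have Fourier transform `1 / log s` with `s = |2πξ|²`. As a function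
of complex `s`, `1 / log s` has a simple pole at `s = 1` with residue `1` and a cut along the
negative axis, where its jump is governed by `1 / (log² t + π²)`. Hence, for positive `s ≠ 1`, `1 /
log s = 1 / (s - 1) + ∫₀^∞ dt / ((t + s)(log² t + π²))`, which is `logRemainder_eq`. Each term is a
resolvent of `-Δ`: the integral superposes `(-Δ + t)⁻¹` with a probability density weighted by `1 /
t`, and the pole is the resolvent at energy `1`, on the spectrum, regularized as `(-Δ - 1 - i0)⁻¹`.

The candidate is therefore the kernel `K(-i, |x|)`, the limit of `K(ε - i, |x|)`, plus the
functional of the bounded remainder symbol on the Fourier side. It inverts `log(-Δ)` because the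
logarithm vanishes at the unit sphere `|2πξ| = 1`: on such test functions the boundary value is
ordinary division by `s - 1`, so the choice of `i0` is invisible (`integral_eq_of_norm_le`,
`distribution_logLaplacian`). Near the origin the symbol is away from the pole, so the Fourier
transform is a bounded function there (`isFunctionOn_fourier`).

The decay comes from one kernel bound, `C |a|^((d-3)/2) r^(-(d-1)/2) e^(-r Re a)`, valid up to the
imaginary axis. At `a = -i` it is the claimed rate. At `a = √t` and `r ≥ 2` it is that rate times an
integrable function of `t`, so the superposition decays equally fast (`norm_remainderKernel_le`).

It remains to produce kernels. On the line it is `e^(-ar) / (2a)`. On the plane, the Laplace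
transform of the heat kernel gives the resolvent for real `a > 0`; a change of variables gives a
formula that makes sense up to the imaginary axis, and the identity theorem extends the resolvent
equation to `Re a > 0`. -/

lemma integrable_exp_smul_comp_exp_iff {E : Type*} [NormedAddCommGroup E] [NormedSpace ℝ E]
    (g : ℝ → E) :
    Integrable (fun v => Real.exp v • g (Real.exp v)) ↔ IntegrableOn g (Ioi 0) := by
  have := integrableOn_image_iff_integrableOn_abs_deriv_smul (s := univ) (f := Real.exp)
    (f' := Real.exp) MeasurableSet.univ (fun x _ => (Real.hasDerivAt_exp x).hasDerivWithinAt)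
    Real.exp_injective.injOn g
  rw [image_univ, Real.range_exp, integrableOn_univ] at this
  simpa only [Real.abs_exp] using this.symm

lemma integral_exp_smul_comp_exp {E : Type*} [NormedAddCommGroup E] [NormedSpace ℝ E]
    (g : ℝ → E) :
    ∫ v, Real.exp v • g (Real.exp v) = ∫ t in Ioi 0, g t := by
  have := integral_image_eq_integral_abs_deriv_smul (s := univ) (f := Real.exp)
    (f' := Real.exp) MeasurableSet.univ (fun x _ => (Real.hasDerivAt_exp x).hasDerivWithinAt)
    Real.exp_injective.injOn g
  rw [image_univ, Real.range_exp, setIntegral_univ] at this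
  simpa only [Real.abs_exp] using this.symm

lemma inv_sq_add_pi_sq (v : ℝ) :
    (v ^ 2 + Real.pi ^ 2)⁻¹ = (Real.pi ^ 2)⁻¹ * (1 + (v * Real.pi⁻¹) ^ 2)⁻¹ := by
  have := Real.pi_pos
  rw [← mul_inv]; congr 1; field_simp; ring

lemma exp_smul_inv_mul_log (v : ℝ) :
    Real.exp v • ((Real.exp v)⁻¹ * (Real.log (Real.exp v) ^ 2 + Real.pi ^ 2)⁻¹) =
      (v ^ 2 + Real.pi ^ 2)⁻¹ := by
  rw [Real.log_exp, smul_eq_mul, ← mul_assoc, mul_inv_cancel₀ (Real.exp_pos v).ne', one_mul]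

lemma integrableOn_inv_mul_log_sq :
    IntegrableOn (fun t : ℝ => t⁻¹ * (Real.log t ^ 2 + Real.pi ^ 2)⁻¹) (Ioi 0) := by
  rw [← integrable_exp_smul_comp_exp_iff]
  simp only [exp_smul_inv_mul_log]
  simp only [inv_sq_add_pi_sq]
  exact (integrable_inv_one_add_sq.comp_mul_right' (inv_ne_zero Real.pi_ne_zero)).const_mul _

/-- The substitution `t = e^v` turns the integrand into `1 / (v² + π²)`, the Cauchy density of scale
`π`. The value `1` makes the residue terms match in `logRemainder_eq`. -/
lemma integral_inv_mul_log_sq :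
    ∫ t in Ioi (0 : ℝ), t⁻¹ * (Real.log t ^ 2 + Real.pi ^ 2)⁻¹ = 1 := by
  rw [← integral_exp_smul_comp_exp]
  simp only [exp_smul_inv_mul_log]
  simp only [inv_sq_add_pi_sq]
  rw [integral_const_mul, Measure.integral_comp_mul_right (fun x : ℝ => (1 + x ^ 2)⁻¹),
    integral_univ_inv_one_add_sq]
  have := Real.pi_pos
  rw [inv_inv, abs_of_pos this, smul_eq_mul]
  field_simp

/-- The function `∫₀^∞ dt / ((t + s) (log² t + π²))`, equal to `1 / log s - 1 / (s - 1)`. -/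
noncomputable def logRemainder (s : ℝ) : ℝ :=
  ∫ t in Ioi (0 : ℝ), (t + s)⁻¹ * (Real.log t ^ 2 + Real.pi ^ 2)⁻¹

lemma inv_add_mul_log_sq_le {s t : ℝ} (hs : 0 ≤ s) (ht : 0 < t) :
    (t + s)⁻¹ * (Real.log t ^ 2 + Real.pi ^ 2)⁻¹ ≤ t⁻¹ * (Real.log t ^ 2 + Real.pi ^ 2)⁻¹ := by
  have := Real.pi_pos
  gcongr
  linarith

lemma integrableOn_logRemainder {s : ℝ} (hs : 0 ≤ s) :
    IntegrableOn (fun t : ℝ => (t + s)⁻¹ * (Real.log t ^ 2 + Real.pi ^ 2)⁻¹) (Ioi 0) := by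
  refine integrableOn_inv_mul_log_sq.mono' (by fun_prop) ?_
  filter_upwards [ae_restrict_mem measurableSet_Ioi] with t ht
  have ht : 0 < t := ht
  rw [Real.norm_of_nonneg (by positivity)]
  exact inv_add_mul_log_sq_le hs ht

lemma logRemainder_nonneg {s : ℝ} (hs : 0 ≤ s) : 0 ≤ logRemainder s :=
  setIntegral_nonneg measurableSet_Ioi fun t ht => by
    have : 0 < t := ht
    positivity

lemma logRemainder_le_one {s : ℝ} (hs : 0 ≤ s) : logRemainder s ≤ 1 := by
  rw [← integral_inv_mul_log_sq]
  exact setIntegral_mono_on (integrableOn_logRemainder hs) integrableOn_inv_mul_log_sq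
    measurableSet_Ioi fun t ht => inv_add_mul_log_sq_le hs ht

lemma measurable_logRemainder : Measurable logRemainder := by
  apply StronglyMeasurable.measurable
  apply StronglyMeasurable.integral_prod_right' (f := fun p : ℝ × ℝ =>
    (p.2 + p.1)⁻¹ * (Real.log p.2 ^ 2 + Real.pi ^ 2)⁻¹)
  apply Measurable.stronglyMeasurable
  fun_prop

lemma integrable_rpow_mul_exp {u r : ℝ} (hu : 0 < u) (hr : 0 < r) :
    IntegrableOn (fun t => t ^ (u - 1) * Real.exp (-(r * t))) (Ioi 0) := by
  have := integrableOn_rpow_mul_exp_neg_mul_rpow (s := u - 1) (p := 1) (b := r)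
    (by linarith) one_pos hr
  simpa only [Real.rpow_one, neg_mul] using this

lemma integral_inner_rpow_div_add {u s t : ℝ} (hs : 0 < s) (ht : 0 < t) :
    ∫ y in Ioi (0 : ℝ), t ^ (-u) * Real.exp (-((t + s) * y)) = t ^ (-u) * (t + s)⁻¹ := by
  rw [integral_const_mul]
  have := Real.integral_rpow_mul_exp_neg_mul_Ioi (a := 1) (r := t + s) one_pos (by linarith)
  simp only [sub_self, Real.rpow_zero, one_mul, Real.rpow_one, Real.Gamma_one, mul_one,
    one_div] at this
  rw [this]

/-- Writing `1 / (t + s)` as `∫ e^(-(t+s)y) dy` and exchanging the integrals gives `Γ(1 - u) Γ(u)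
s^(-u)`; Euler's reflection formula supplies the sine. -/
lemma integral_rpow_div_add {u s : ℝ} (hu0 : 0 < u) (hu1 : u < 1) (hs : 0 < s) :
    IntegrableOn (fun t : ℝ => t ^ (-u) * (t + s)⁻¹) (Ioi 0) ∧
    ∫ t in Ioi (0 : ℝ), t ^ (-u) * (t + s)⁻¹ = Real.pi / Real.sin (Real.pi * u) * s ^ (-u) := by
  let f : ℝ → ℝ → ℝ := fun t y => t ^ (-u) * Real.exp (-((t + s) * y))
  have hf : ∀ y t, f t y = Real.exp (-(s * y)) * (t ^ ((1 - u) - 1) * Real.exp (-(y * t))) := by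
    intro y t
    simp only [f]
    rw [show (1 - u) - 1 = -u by ring, mul_left_comm, ← Real.exp_add]
    congr 2; ring
  have hin : ∀ y ∈ Ioi (0 : ℝ), ∫ t in Ioi (0 : ℝ), f t y =
      Real.Gamma (1 - u) * (y ^ (u - 1) * Real.exp (-(s * y))) := by
    intro y hy
    have hy : 0 < y := hy
    simp only [hf]
    rw [integral_const_mul, Real.integral_rpow_mul_exp_neg_mul_Ioi (by linarith) hy,
      one_div, Real.inv_rpow hy.le, ← Real.rpow_neg hy.le]
    rw [show -(1 - u) = u - 1 by ring]; ring
  have hmeas : AEStronglyMeasurable (Function.uncurry f)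
      ((volume.restrict (Ioi (0 : ℝ))).prod (volume.restrict (Ioi (0 : ℝ)))) := by
    apply Measurable.aestronglyMeasurable
    simp only [f, Function.uncurry_def]
    fun_prop
  have hint : Integrable (Function.uncurry f)
      ((volume.restrict (Ioi (0 : ℝ))).prod (volume.restrict (Ioi (0 : ℝ)))) := by
    rw [integrable_prod_iff' hmeas]
    constructor
    · filter_upwards [ae_restrict_mem measurableSet_Ioi] with y hy
      simp only [Function.uncurry, hf]
      exact (integrable_rpow_mul_exp (by linarith) hy).const_mul _
    · have : IntegrableOn (fun y => Real.Gamma (1 - u) * (y ^ (u - 1) * Real.exp (-(s * y))))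
          (Ioi 0) := (integrable_rpow_mul_exp hu0 hs).const_mul _
      refine this.congr ?_
      filter_upwards [ae_restrict_mem measurableSet_Ioi] with y hy
      rw [← hin y hy]
      refine setIntegral_congr_fun measurableSet_Ioi fun t ht => ?_
      have ht : 0 < t := ht
      simp only [Function.uncurry, f]
      rw [Real.norm_of_nonneg (by positivity)]
  have hleft : ∀ t ∈ Ioi (0 : ℝ), ∫ y in Ioi (0 : ℝ), f t y = t ^ (-u) * (t + s)⁻¹ :=
    fun t ht => integral_inner_rpow_div_add hs ht
  constructor
  · refine hint.integral_prod_left.congr ?_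
    filter_upwards [ae_restrict_mem measurableSet_Ioi] with t ht
    exact hleft t ht
  · rw [← setIntegral_congr_fun measurableSet_Ioi hleft, integral_integral_swap hint,
      setIntegral_congr_fun measurableSet_Ioi hin, integral_const_mul,
      Real.integral_rpow_mul_exp_neg_mul_Ioi hu0 hs, ← Real.Gamma_mul_Gamma_one_sub,
      one_div, Real.inv_rpow hs.le, Real.rpow_neg hs.le]
    ring

/-- An elementary antiderivative of `e^(-Lu) sin(πu)` with `L = log t`. The endpoints `u = 0` and `u
= 1` contribute `1` and `t⁻¹`. This is how the spectral density arises from real powers, without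
contour integration. -/
lemma integral_rpow_mul_sin {t : ℝ} (ht : 0 < t) :
    ∫ u in (0 : ℝ)..1, t ^ (-u) * Real.sin (Real.pi * u) =
      Real.pi * (1 + t⁻¹) * (Real.log t ^ 2 + Real.pi ^ 2)⁻¹ := by
  set L := Real.log t with hL
  have hpi := Real.pi_pos
  have hD : L ^ 2 + Real.pi ^ 2 ≠ 0 := by positivity
  have hrp : ∀ u : ℝ, t ^ (-u) = Real.exp (-(L * u)) := fun u => by
    rw [Real.rpow_def_of_pos ht, ← hL]; congr 1; ring
  have hd : ∀ u ∈ uIcc (0 : ℝ) 1, HasDerivAt (fun u => -(Real.exp (-(L * u)) *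
      (L * Real.sin (Real.pi * u) + Real.pi * Real.cos (Real.pi * u))) * (L ^ 2 + Real.pi ^ 2)⁻¹)
      (t ^ (-u) * Real.sin (Real.pi * u)) u := by
    intro u _
    rw [hrp]
    have h1 : HasDerivAt (fun u => Real.pi * u) Real.pi u := by
      simpa using (hasDerivAt_id u).const_mul Real.pi
    have h2 : HasDerivAt (fun u => -(L * u)) (-L) u := by
      simpa using ((hasDerivAt_id u).const_mul L).fun_neg
    have := (((h2.exp).fun_mul ((h1.sin.const_mul L).fun_add
      (h1.cos.const_mul Real.pi))).fun_neg).mul_const (L ^ 2 + Real.pi ^ 2)⁻¹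
    refine this.congr_deriv ?_
    field_simp
    ring
  rw [intervalIntegral.integral_eq_sub_of_hasDerivAt hd]
  · have : Real.exp (-L) = t⁻¹ := by rw [Real.exp_neg, hL, Real.exp_log ht]
    simp [this]
    ring
  · apply Continuous.intervalIntegrable
    simp only [hrp]
    fun_prop

lemma integral_rpow_neg_unit {s : ℝ} (hs : 0 < s) (hs1 : s ≠ 1) :
    ∫ u in (0 : ℝ)..1, s ^ (-u) = (1 - s⁻¹) * (Real.log s)⁻¹ := by
  have hL : Real.log s ≠ 0 := Real.log_ne_zero_of_pos_of_ne_one hs hs1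
  have hrp : ∀ u : ℝ, s ^ (-u) = Real.exp (-Real.log s * u) := fun u => by
    rw [Real.rpow_def_of_pos hs]; congr 1; ring
  simp only [hrp]
  rw [intervalIntegral.integral_comp_mul_left (fun x => Real.exp x) (neg_ne_zero.2 hL),
    integral_exp, mul_zero, mul_one, Real.exp_zero, Real.exp_neg, Real.exp_log hs, smul_eq_mul]
  field_simp
  ring

/-- Multiplying the Mellin integral `∫ t^(-u) / (t + s) dt = π s^(-u) / sin(πu)` by `sin(πu)` and
integrating over `0 < u < 1` leaves `π ∫ s^(-u) du` on one side; Fubini and `integral_rpow_mul_sin`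
evaluate the other. -/
lemma integral_one_add_inv_mul_log_sq {s : ℝ} (hs : 0 < s) (hs1 : s ≠ 1) :
    ∫ t in Ioi (0 : ℝ), (1 + t⁻¹) * (t + s)⁻¹ * (Real.log t ^ 2 + Real.pi ^ 2)⁻¹ =
      (1 - s⁻¹) * (Real.log s)⁻¹ := by
  have hpi := Real.pi_pos
  let f : ℝ → ℝ → ℝ := fun t u => t ^ (-u) * (t + s)⁻¹ * Real.sin (Real.pi * u)
  have hsin : ∀ u ∈ Ioo (0 : ℝ) 1, 0 < Real.sin (Real.pi * u) := fun u hu =>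
    Real.sin_pos_of_pos_of_lt_pi (mul_pos hpi hu.1) (by nlinarith [hu.2])
  have hin : ∀ u ∈ Ioo (0 : ℝ) 1, ∫ t in Ioi (0 : ℝ), f t u = Real.pi * s ^ (-u) := by
    intro u hu
    have := (hsin u hu).ne'
    simp only [f]
    rw [integral_mul_const, (integral_rpow_div_add hu.1 hu.2 hs).2]
    field_simp
  have hmeas : AEStronglyMeasurable (Function.uncurry f)
      ((volume.restrict (Ioi (0 : ℝ))).prod (volume.restrict (Ioo (0 : ℝ) 1))) := by
    apply Measurable.aestronglyMeasurable
    simp only [f, Function.uncurry_def]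
    fun_prop
  have hcont : Continuous fun u : ℝ => s ^ (-u) :=
    (Real.continuous_const_rpow hs.ne').comp continuous_neg
  have hint : Integrable (Function.uncurry f)
      ((volume.restrict (Ioi (0 : ℝ))).prod (volume.restrict (Ioo (0 : ℝ) 1))) := by
    rw [integrable_prod_iff' hmeas]
    constructor
    · filter_upwards [ae_restrict_mem measurableSet_Ioo] with u hu
      exact (integral_rpow_div_add hu.1 hu.2 hs).1.mul_const (Real.sin (Real.pi * u))
    · have : IntegrableOn (fun u : ℝ => Real.pi * s ^ (-u)) (Ioo 0 1) :=
        ((hcont.const_mul _).integrableOn_Icc).mono_set Ioo_subset_Icc_self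
      refine this.congr ?_
      filter_upwards [ae_restrict_mem measurableSet_Ioo] with u hu
      rw [← hin u hu]
      refine setIntegral_congr_fun measurableSet_Ioi fun t ht => ?_
      have ht : 0 < t := ht
      have := hsin u hu
      simp only [Function.uncurry, f]
      rw [Real.norm_of_nonneg (by positivity)]
  have hleft : ∀ t ∈ Ioi (0 : ℝ), ∫ u in Ioo (0 : ℝ) 1, f t u =
      Real.pi * ((1 + t⁻¹) * (t + s)⁻¹ * (Real.log t ^ 2 + Real.pi ^ 2)⁻¹) := by
    intro t ht
    have := integral_rpow_mul_sin ht
    rw [intervalIntegral.integral_of_le zero_le_one, integral_Ioc_eq_integral_Ioo] at this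
    simp only [f, mul_right_comm _ (t + s)⁻¹]
    rw [integral_mul_const, this]
    ring
  have h1 := setIntegral_congr_fun (μ := volume) measurableSet_Ioi hleft
  have h2 := integral_rpow_neg_unit hs hs1
  rw [intervalIntegral.integral_of_le zero_le_one, integral_Ioc_eq_integral_Ioo] at h2
  rw [integral_integral_swap hint, setIntegral_congr_fun measurableSet_Ioo hin,
    integral_const_mul, integral_const_mul, h2] at h1
  exact (mul_left_cancel₀ hpi.ne' h1).symm

lemma logRemainder_eq {s : ℝ} (hs : 0 < s) (hs1 : s ≠ 1) :
    logRemainder s = (Real.log s)⁻¹ - (s - 1)⁻¹ := by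
  have hL : Real.log s ≠ 0 := Real.log_ne_zero_of_pos_of_ne_one hs hs1
  have hsub : s - 1 ≠ 0 := sub_ne_zero.2 hs1
  have h := integral_one_add_inv_mul_log_sq hs hs1
  have key : ∀ t ∈ Ioi (0 : ℝ), (1 + t⁻¹) * (t + s)⁻¹ * (Real.log t ^ 2 + Real.pi ^ 2)⁻¹ =
      (1 - s⁻¹) * ((t + s)⁻¹ * (Real.log t ^ 2 + Real.pi ^ 2)⁻¹) +
        s⁻¹ * (t⁻¹ * (Real.log t ^ 2 + Real.pi ^ 2)⁻¹) := by
    intro t ht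
    have ht : 0 < t := ht
    -- This splitting separates the wanted integral from one of known total mass; dividing by `1 -
    -- s⁻¹` then produces the pole `1 / (s - 1)`.
    have e : (1 + t⁻¹) * (t + s)⁻¹ = (1 - s⁻¹) * (t + s)⁻¹ + s⁻¹ * t⁻¹ := by
      field_simp
      ring
    rw [e]; ring
  rw [setIntegral_congr_fun measurableSet_Ioi key, integral_add
    ((integrableOn_logRemainder hs.le).const_mul _) (integrableOn_inv_mul_log_sq.const_mul _),
    integral_const_mul, integral_const_mul, integral_inv_mul_log_sq] at h
  change (1 - s⁻¹) * logRemainder s + _ = _ at h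
  field_simp at h ⊢
  linear_combination h

end LogRepresentation

/-! ### Functions of polynomial growth as tempered distributions -/

section TemperedFunction

variable {d : ℕ}

lemma norm_mul_schwartz_le (g : EuclideanSpace ℝ (Fin d) → ℂ) (k : ℕ)
    (φ : 𝓢(EuclideanSpace ℝ (Fin d), ℂ)) (x : EuclideanSpace ℝ (Fin d)) :
    ‖g x * φ x‖ ≤ 2 ^ k * (Finset.Iic ((k, 0) : ℕ × ℕ)).sup
      (schwartzSeminormFamily ℂ (EuclideanSpace ℝ (Fin d)) ℂ) φ *
        (((1 + ‖x‖) ^ k)⁻¹ * ‖g x‖) := by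
  have h := SchwartzMap.one_add_le_sup_seminorm_apply (𝕜 := ℂ) (m := (k, 0)) (k := k) (n := 0)
    le_rfl le_rfl φ x
  rw [norm_iteratedFDeriv_zero] at h
  have hp : 0 < (1 + ‖x‖) ^ k := by positivity
  rw [norm_mul, mul_comm, ← mul_assoc]
  gcongr
  rw [← div_eq_mul_inv, le_div_iff₀ hp, mul_comm]
  exact h

lemma integrable_mul_schwartz {g : EuclideanSpace ℝ (Fin d) → ℂ} (hg : Measurable g) {k : ℕ}
    (hk : Integrable fun x => ((1 + ‖x‖) ^ k)⁻¹ * ‖g x‖) (φ : 𝓢(EuclideanSpace ℝ (Fin d), ℂ)) :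
    Integrable fun x => g x * φ x :=
  (hk.const_mul _).mono' (hg.aestronglyMeasurable.mul φ.continuous.aestronglyMeasurable)
    (Eventually.of_forall fun x => norm_mul_schwartz_le g k φ x)

/-- Integration against a function of polynomial growth in the mean, as a functional on the
Schwartz space. -/
noncomputable def integralMulCLM {g : EuclideanSpace ℝ (Fin d) → ℂ} (hg : Measurable g) {k : ℕ}
    (hk : Integrable fun x => ((1 + ‖x‖) ^ k)⁻¹ * ‖g x‖) :
    𝓢(EuclideanSpace ℝ (Fin d), ℂ) →L[ℂ] ℂ :=
  SchwartzMap.mkCLMtoNormedSpace (fun φ => ∫ x, g x * φ x)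
    (fun φ ψ => by
      simp only [add_apply, mul_add]
      exact integral_add (integrable_mul_schwartz hg hk φ) (integrable_mul_schwartz hg hk ψ))
    (fun c φ => by
      simp only [smul_apply, smul_eq_mul, mul_left_comm _ c, RingHom.id_apply]
      exact integral_const_mul _ _)
    ⟨Finset.Iic (k, 0), 2 ^ k * ∫ x, ((1 + ‖x‖) ^ k)⁻¹ * ‖g x‖,
      mul_nonneg (by positivity) (integral_nonneg fun x => by positivity), fun φ => by
      refine (norm_integral_le_of_norm_le (hk.const_mul _)
        (Eventually.of_forall fun x => norm_mul_schwartz_le g k φ x)).trans (le_of_eq ?_)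
      rw [integral_const_mul]
      ring⟩

lemma integrable_one_add_norm_pow_inv :
    Integrable fun x : EuclideanSpace ℝ (Fin d) => ((1 + ‖x‖) ^ (d + 1))⁻¹ := by
  have := integrable_one_add_norm (E := EuclideanSpace ℝ (Fin d)) (μ := volume)
    (r := ((d + 1 : ℕ) : ℝ)) (by simp)
  refine this.congr (Eventually.of_forall fun x => ?_)
  simp only
  rw [Real.rpow_neg (by positivity), Real.rpow_natCast]

/-- In polar coordinates the Jacobian `r^(d-1)` absorbs the singularity, leaving `r^((d-1)/2)`, and
the weight brings the integrand below `(1 + r)^(-2)`. -/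
lemma integrable_norm_rpow_decay (hd : 1 ≤ d) :
    Integrable fun x : EuclideanSpace ℝ (Fin d) =>
      ((1 + ‖x‖) ^ (d + 1))⁻¹ * ‖x‖ ^ (-(((d : ℝ) - 1) / 2)) := by
  have : Nonempty (Fin d) := ⟨⟨0, hd⟩⟩
  set β : ℝ := ((d : ℝ) - 1) / 2 with hβ
  have hd' : (1 : ℝ) ≤ d := by exact_mod_cast hd
  have hβ0 : 0 ≤ β := by rw [hβ]; linarith
  rw [integrable_fun_norm_addHaar volume
    (f := fun y : ℝ => ((1 + y) ^ (d + 1))⁻¹ * y ^ (-β)), finrank_euclideanSpace_fin]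
  have h1 : Integrable fun y : ℝ => (1 + ‖y‖) ^ (-(2 : ℝ)) :=
    integrable_one_add_norm (by simp)
  refine h1.integrableOn.mono' (by fun_prop) ?_
  filter_upwards [ae_restrict_mem measurableSet_Ioi] with y hy
  have hy : 0 < y := hy
  rw [Real.norm_of_nonneg (by simp only [smul_eq_mul]; positivity), Real.norm_of_nonneg hy.le,
    smul_eq_mul]
  have e1 : y ^ (d - 1) = y ^ ((d : ℝ) - 1) := by
    rw [← Real.rpow_natCast, Nat.cast_sub hd, Nat.cast_one]
  have e2 : ((1 + y) ^ (d + 1))⁻¹ = (1 + y) ^ (-((d : ℝ) + 1)) := by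
    rw [Real.rpow_neg (by positivity)]; norm_cast
  have e3 : y ^ ((d : ℝ) - 1) * y ^ (-β) = y ^ β := by
    rw [← Real.rpow_add hy]; congr 1; rw [hβ]; ring
  calc y ^ (d - 1) * (((1 + y) ^ (d + 1))⁻¹ * y ^ (-β))
      = (1 + y) ^ (-((d : ℝ) + 1)) * y ^ β := by rw [← e3, e1, e2]; ring
    _ ≤ (1 + y) ^ (-((d : ℝ) + 1)) * (1 + y) ^ β := by gcongr; linarith
    _ = (1 + y) ^ (-((d : ℝ) + 1) + β) := by rw [Real.rpow_add (by positivity)]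
    _ ≤ _ := Real.rpow_le_rpow_of_exponent_le (by linarith) (by rw [hβ]; linarith)

lemma integrable_norm_rpow_mul_schwartz (hd : 1 ≤ d) (φ : 𝓢(EuclideanSpace ℝ (Fin d), ℂ)) :
    Integrable fun x : EuclideanSpace ℝ (Fin d) =>
      ((‖x‖ ^ (-(((d : ℝ) - 1) / 2)) : ℝ) : ℂ) * φ x := by
  refine integrable_mul_schwartz (k := d + 1) (by fun_prop) ?_ φ
  refine (integrable_norm_rpow_decay hd).congr (Eventually.of_forall fun x => ?_)
  simp only [Complex.norm_real]
  rw [Real.norm_of_nonneg (by positivity)]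

end TemperedFunction

/-- The symbol `|2πξ|²` of `-Δ`. -/
noncomputable def laplaceSymbol {d : ℕ} (ξ : EuclideanSpace ℝ (Fin d)) : ℝ :=
  ‖(2 * Real.pi) • ξ‖ ^ 2

/-! ### The symbol of the Laplacian near the unit sphere -/

section Symbol

variable {d : ℕ}

lemma laplaceSymbol_nonneg (ξ : EuclideanSpace ℝ (Fin d)) : 0 ≤ laplaceSymbol ξ := by
  unfold laplaceSymbol; positivity

lemma continuous_laplaceSymbol : Continuous (laplaceSymbol (d := d)) := by
  unfold laplaceSymbol; fun_prop

lemma laplaceSymbol_eq (ξ : EuclideanSpace ℝ (Fin d)) :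
    laplaceSymbol ξ = 4 * Real.pi ^ 2 * ‖ξ‖ ^ 2 := by
  rw [laplaceSymbol, norm_smul, Real.norm_of_nonneg (by positivity)]; ring

lemma laplaceSymbol_neg (ξ : EuclideanSpace ℝ (Fin d)) :
    laplaceSymbol (-ξ) = laplaceSymbol ξ := by
  rw [laplaceSymbol_eq, laplaceSymbol_eq, norm_neg]

lemma ae_laplaceSymbol_ne (hd : 1 ≤ d) :
    ∀ᵐ ξ : EuclideanSpace ℝ (Fin d), 0 < laplaceSymbol ξ ∧ laplaceSymbol ξ ≠ 1 := by
  have : Nonempty (Fin d) := ⟨⟨0, hd⟩⟩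
  have hpi := Real.pi_pos
  have h1 : ∀ᵐ ξ : EuclideanSpace ℝ (Fin d), ξ ∉ Metric.sphere (0 : EuclideanSpace ℝ (Fin d)) 0 :=
    measure_eq_zero_iff_ae_notMem.1 (Measure.addHaar_sphere _ _ _)
  have h2 : ∀ᵐ ξ : EuclideanSpace ℝ (Fin d),
      ξ ∉ Metric.sphere (0 : EuclideanSpace ℝ (Fin d)) (2 * Real.pi)⁻¹ :=
    measure_eq_zero_iff_ae_notMem.1 (Measure.addHaar_sphere _ _ _)
  filter_upwards [h1, h2] with ξ hξ1 hξ2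
  have h0 : 0 < ‖ξ‖ := by
    rw [norm_pos_iff]; rintro rfl; simp at hξ1
  rw [laplaceSymbol_eq]
  refine ⟨by positivity, fun h => hξ2 ?_⟩
  have h3 : (2 * Real.pi * ‖ξ‖) ^ 2 = 1 := by rw [← h]; ring
  have h4 : 2 * Real.pi * ‖ξ‖ = 1 := by
    rwa [pow_eq_one_iff_of_nonneg (by positivity) two_ne_zero] at h3
  rw [mem_sphere_zero_iff_norm]
  field_simp
  linarith

/-- The squared modulus on the right is `(s - 1)² + 2ε²s + 2ε² + ε⁴`. The bound dominates the
regularized quotients uniformly as `ε → 0`. -/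
lemma abs_sub_one_le_norm (s ε : ℝ) (hs : 0 ≤ s) :
    |s - 1| ≤ ‖(s : ℂ) + ((ε : ℂ) - Complex.I) ^ 2‖ := by
  have e : (s : ℂ) + ((ε : ℂ) - Complex.I) ^ 2 = ((s - 1 + ε ^ 2 : ℝ) : ℂ) +
      ((-2 * ε : ℝ) : ℂ) * Complex.I := by
    push_cast; linear_combination Complex.I_sq
  rw [e, Complex.norm_add_mul_I]
  apply Real.abs_le_sqrt
  nlinarith [sq_nonneg ε, mul_nonneg hs (sq_nonneg ε), sq_nonneg (ε ^ 2)]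

/-- Where `|s - 1| ≥ 1/2` the term with `2 |log s|` suffices, and closer to `1` the logarithm is at
most `3 |s - 1|`. Keeping `|log s|` on the right is harmless: the logarithm times the Fourier
transform of a Lizorkin function is again a Schwartz function. -/
lemma abs_log_le_mul_abs_sub_one (s : ℝ) :
    |Real.log s| ≤ (3 + 2 * |Real.log s|) * |s - 1| := by
  have h0 := abs_nonneg (Real.log s)
  rcases le_total (1 / 2) |s - 1| with h | h
  · nlinarith
  · have hs' : 1 / 2 ≤ s := by linarith [(abs_le.1 h).1]
    have h1 := Real.log_le_sub_one_of_pos (by linarith : 0 < s)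
    have h2 := Real.one_sub_inv_le_log_of_pos (by linarith : 0 < s)
    have h4 : |Real.log s| ≤ 3 * |s - 1| := by
      have h5 : 1 - s⁻¹ = (s - 1) * s⁻¹ := by field_simp
      have h6 : s⁻¹ ≤ 2 := by
        rw [inv_le_comm₀ (by linarith) two_pos]; linarith
      have h7 : 0 ≤ s⁻¹ := by positivity
      have h8 : -(|s - 1| * 2) ≤ (s - 1) * s⁻¹ := by
        have : |(s - 1) * s⁻¹| ≤ |s - 1| * 2 := by
          rw [abs_mul, abs_of_nonneg h7]; gcongr
        linarith [(abs_le.1 this).1]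
      rw [abs_le]
      constructor
      · linarith [abs_nonneg (s - 1)]
      · linarith [le_abs_self (s - 1), abs_nonneg (s - 1)]
    nlinarith [abs_nonneg (s - 1)]

end Symbol

/-- `K a ‖x‖` is the kernel of the resolvent `(-Δ + a²)⁻¹` on `ℝᵈ` for `Re a > 0`, with bounds
that are uniform up to the imaginary axis and with boundary values at `a = -i`. -/
structure IsResolventKernel (d : ℕ) (K : ℂ → ℝ → ℂ) (C : ℝ) : Prop where
  measurable : Measurable (Function.uncurry K)
  -- The power of `r` is the decay rate of waves on the spectrum; the power of `‖a‖` is then forced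
  -- by the scaling `K a r = a^(d-2) K 1 (a r)`.
  norm_le : ∀ a : ℂ, 0 ≤ a.re → a ≠ 0 → ∀ r : ℝ, 0 < r →
    ‖K a r‖ ≤ C * ‖a‖ ^ (-(1 - ((d : ℝ) - 1) / 2)) * r ^ (-(((d : ℝ) - 1) / 2)) *
      Real.exp (-(r * a.re))
  tendsto : ∀ r : ℝ, 0 < r →
    Tendsto (fun ε : ℝ => K ((ε : ℂ) - Complex.I) r) (𝓝[>] 0) (𝓝 (K (-Complex.I) r))
  resolvent : ∀ a : ℂ, 0 < a.re → ∀ φ : 𝓢(EuclideanSpace ℝ (Fin d), ℂ),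
    ∫ x, K a ‖x‖ * φ x = ∫ ξ, ((laplaceSymbol ξ : ℂ) + a ^ 2)⁻¹ * (𝓕⁻ φ : 𝓢(_, ℂ)) ξ

/-! ### The boundary value at energy one and the inversion of the logarithm -/

namespace IsResolventKernel

variable {d : ℕ} {K : ℂ → ℝ → ℂ} {C : ℝ}

lemma ae_norm_pos (hd : 1 ≤ d) : ∀ᵐ x : EuclideanSpace ℝ (Fin d), 0 < ‖x‖ := by
  filter_upwards [ae_laplaceSymbol_ne hd] with x hx
  rw [norm_pos_iff]
  rintro rfl
  simp [laplaceSymbol] at hx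

lemma const_nonneg (hK : IsResolventKernel d K C) : 0 ≤ C := by
  have := (norm_nonneg _).trans (hK.norm_le 1 (by simp) one_ne_zero 1 one_pos)
  simpa [Real.exp_pos] using this

lemma measurable_comp_norm (hK : IsResolventKernel d K C) (a : ℂ) :
    Measurable fun x : EuclideanSpace ℝ (Fin d) => K a ‖x‖ :=
  hK.measurable.comp (measurable_const.prodMk _root_.measurable_norm)

lemma integrable_decay (hK : IsResolventKernel d K C) (hd : 1 ≤ d) {a : ℂ} (ha : 0 ≤ a.re)
    (ha0 : a ≠ 0) :
    Integrable fun x : EuclideanSpace ℝ (Fin d) => ((1 + ‖x‖) ^ (d + 1))⁻¹ * ‖K a ‖x‖‖ := by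
  have hm := hK.measurable_comp_norm (d := d) a
  refine ((integrable_norm_rpow_decay hd).const_mul
    (C * ‖a‖ ^ (-(1 - ((d : ℝ) - 1) / 2)))).mono'
    (Measurable.mul (by fun_prop) hm.norm).aestronglyMeasurable ?_
  filter_upwards [ae_norm_pos hd] with x hx
  have hC := hK.const_nonneg
  rw [Real.norm_of_nonneg (by positivity), mul_left_comm]
  gcongr
  refine (hK.norm_le a ha ha0 _ hx).trans (mul_le_of_le_one_right (by positivity) ?_)
  exact Real.exp_le_one_iff.2 (by nlinarith)

lemma tendsto_integral (hK : IsResolventKernel d K C) (hd : d = 1 ∨ d = 2)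
    (φ : 𝓢(EuclideanSpace ℝ (Fin d), ℂ)) :
    Tendsto (fun ε : ℝ => ∫ x, K ((ε : ℂ) - Complex.I) ‖x‖ * φ x) (𝓝[>] 0)
      (𝓝 (∫ x, K (-Complex.I) ‖x‖ * φ x)) := by
  have hd1 : 1 ≤ d := by omega
  have hC := hK.const_nonneg
  have hd2 : (d : ℝ) ≤ 2 := by exact_mod_cast (by omega : d ≤ 2)
  let G : EuclideanSpace ℝ (Fin d) → ℂ := fun x => ((‖x‖ ^ (-(((d : ℝ) - 1) / 2)) : ℝ) : ℂ)
  have hG : Integrable fun x => G x * φ x := integrable_norm_rpow_mul_schwartz hd1 φ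
  refine tendsto_integral_filter_of_dominated_convergence (fun x => C * ‖G x * φ x‖) ?_ ?_
    (hG.norm.const_mul C) ?_
  · exact Eventually.of_forall fun ε =>
      (hK.measurable_comp_norm _).aestronglyMeasurable.mul φ.continuous.aestronglyMeasurable
  · filter_upwards [self_mem_nhdsWithin] with ε hε
    have hε : 0 < ε := hε
    filter_upwards [ae_norm_pos hd1] with x hx
    have hn : 1 ≤ ‖(ε : ℂ) - Complex.I‖ := by
      have := Complex.abs_im_le_norm ((ε : ℂ) - Complex.I)
      simpa using this
    have hre : ((ε : ℂ) - Complex.I).re = ε := by simp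
    rw [norm_mul, norm_mul, ← mul_assoc]
    gcongr
    refine (hK.norm_le _ (by rw [hre]; exact hε.le) (by rw [← norm_pos_iff]; linarith) _
      hx).trans ?_
    rw [hre]
    simp only [G, Complex.norm_real]
    rw [Real.norm_of_nonneg (by positivity), mul_assoc, mul_assoc]
    -- The exponent is `(d - 3) / 2`, which is negative in dimensions one and two, and the base is
    -- at least `1`.
    have h1 : ‖(ε : ℂ) - Complex.I‖ ^ (-(1 - ((d : ℝ) - 1) / 2)) ≤ 1 :=
      Real.rpow_le_one_of_one_le_of_nonpos hn (by linarith)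
    have h2 : Real.exp (-(‖x‖ * ε)) ≤ 1 := Real.exp_le_one_iff.2 (by nlinarith)
    gcongr
    calc _ ≤ 1 * (‖x‖ ^ (-(((d : ℝ) - 1) / 2)) * 1) := by gcongr
      _ = _ := by ring
  · filter_upwards [ae_norm_pos hd1] with x hx
    exact (hK.tendsto _ hx).mul_const _

/-- The boundary value of the resolvent at energy `1` acts as division by `|2πξ|² - 1` on functions
that vanish on the unit sphere. -/
lemma integral_eq_of_norm_le (hK : IsResolventKernel d K C) (hd : d = 1 ∨ d = 2)
    (φ : 𝓢(EuclideanSpace ℝ (Fin d), ℂ)) {B : EuclideanSpace ℝ (Fin d) → ℝ} (hB : Integrable B)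
    (hφ : ∀ ξ, ‖(𝓕⁻ φ : 𝓢(_, ℂ)) ξ‖ ≤ B ξ * |laplaceSymbol ξ - 1|) :
    Integrable (fun ξ => ((laplaceSymbol ξ : ℂ) - 1)⁻¹ * (𝓕⁻ φ : 𝓢(_, ℂ)) ξ) ∧
    ∫ x, K (-Complex.I) ‖x‖ * φ x =
      ∫ ξ, ((laplaceSymbol ξ : ℂ) - 1)⁻¹ * (𝓕⁻ φ : 𝓢(_, ℂ)) ξ := by
  have hm := (continuous_laplaceSymbol (d := d)).measurable
  -- One majorant serves every regularized denominator. On the sphere itself the numerator vanishes,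
  -- so the quotient is `0` whatever `z` is.
  have hmain : ∀ (ξ : EuclideanSpace ℝ (Fin d)) (z : ℂ), |laplaceSymbol ξ - 1| ≤ ‖z‖ →
      ‖z⁻¹ * (𝓕⁻ φ : 𝓢(_, ℂ)) ξ‖ ≤ ‖B ξ‖ := by
    intro ξ z hz
    rcases (abs_nonneg (laplaceSymbol ξ - 1)).eq_or_lt with h | h
    · have := hφ ξ
      rw [← h, mul_zero] at this
      rw [norm_mul, le_antisymm this (norm_nonneg _), mul_zero]
      positivity
    · rw [norm_mul, norm_inv, inv_mul_le_iff₀ (h.trans_le hz), mul_comm]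
      refine (hφ ξ).trans ?_
      gcongr
      exact Real.le_norm_self _
  constructor
  · refine hB.norm.mono' ?_ (Eventually.of_forall fun ξ => hmain ξ _ ?_)
    · exact (by fun_prop : Measurable fun ξ : EuclideanSpace ℝ (Fin d) =>
        ((laplaceSymbol ξ : ℂ) - 1)⁻¹).aestronglyMeasurable.mul
          (𝓕⁻ φ : 𝓢(_, ℂ)).continuous.aestronglyMeasurable
    · rw [← Complex.ofReal_one, ← Complex.ofReal_sub, Complex.norm_real, Real.norm_eq_abs]
  -- Both sides are limits of the resolvent identity at `a = ε - i`, for which `a²` tends to `-1`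
  -- from below the real axis.
  · refine tendsto_nhds_unique (hK.tendsto_integral hd φ) ?_
    have : Tendsto (fun ε : ℝ => ∫ ξ, ((laplaceSymbol ξ : ℂ) + ((ε : ℂ) - Complex.I) ^ 2)⁻¹ *
        (𝓕⁻ φ : 𝓢(_, ℂ)) ξ) (𝓝[>] 0)
        (𝓝 (∫ ξ, ((laplaceSymbol ξ : ℂ) - 1)⁻¹ * (𝓕⁻ φ : 𝓢(_, ℂ)) ξ)) := by
      refine tendsto_integral_filter_of_dominated_convergence (fun ξ => ‖B ξ‖) ?_ ?_ hB.norm ?_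
      · exact Eventually.of_forall fun ε =>
          (by fun_prop : Measurable fun ξ : EuclideanSpace ℝ (Fin d) =>
            ((laplaceSymbol ξ : ℂ) + ((ε : ℂ) - Complex.I) ^ 2)⁻¹).aestronglyMeasurable.mul
              (𝓕⁻ φ : 𝓢(_, ℂ)).continuous.aestronglyMeasurable
      · exact Eventually.of_forall fun ε => Eventually.of_forall fun ξ =>
          hmain ξ _ (abs_sub_one_le_norm _ _ (laplaceSymbol_nonneg ξ))
      · filter_upwards [ae_laplaceSymbol_ne (by omega)] with ξ hξ
        apply Tendsto.mul_const
        have hc : Continuous fun ε : ℝ => (laplaceSymbol ξ : ℂ) + ((ε : ℂ) - Complex.I) ^ 2 := by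
          fun_prop
        have h0 : (laplaceSymbol ξ : ℂ) + (((0 : ℝ) : ℂ) - Complex.I) ^ 2 =
            (laplaceSymbol ξ : ℂ) - 1 := by simp [sub_eq_add_neg]
        have := (hc.tendsto 0).mono_left (nhdsWithin_le_nhds (s := Set.Ioi 0))
        rw [h0] at this
        refine this.inv₀ ?_
        rw [sub_ne_zero]
        exact_mod_cast hξ.2
    refine this.congr' ?_
    filter_upwards [self_mem_nhdsWithin] with ε hε
    exact (hK.resolvent _ (by simpa using hε) φ).symm

lemma measurable_remainder :
    Measurable fun ξ : EuclideanSpace ℝ (Fin d) => (logRemainder (laplaceSymbol ξ) : ℂ) :=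
  Complex.measurable_ofReal.comp
    (measurable_logRemainder.comp continuous_laplaceSymbol.measurable)

lemma norm_remainder_le (ξ : EuclideanSpace ℝ (Fin d)) :
    ‖(logRemainder (laplaceSymbol ξ) : ℂ)‖ ≤ 1 := by
  rw [Complex.norm_real, Real.norm_of_nonneg (logRemainder_nonneg (laplaceSymbol_nonneg ξ))]
  exact logRemainder_le_one (laplaceSymbol_nonneg ξ)

lemma integrable_remainder_decay :
    Integrable fun ξ : EuclideanSpace ℝ (Fin d) =>
      ((1 + ‖ξ‖) ^ (d + 1))⁻¹ * ‖(logRemainder (laplaceSymbol ξ) : ℂ)‖ := by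
  have := measurable_remainder (d := d)
  refine integrable_one_add_norm_pow_inv.mono' (by fun_prop) (Eventually.of_forall fun ξ => ?_)
  rw [Real.norm_of_nonneg (by positivity)]
  exact mul_le_of_le_one_right (by positivity) (norm_remainder_le ξ)

/-- The tempered distribution whose Fourier transform is `1 / log |2πξ|²`, with the boundary value
`1 / (|2πξ|² - 1 - i0)` at the unit sphere. -/
noncomputable def distribution (hK : IsResolventKernel d K C) (hd : 1 ≤ d) :
    𝓢(EuclideanSpace ℝ (Fin d), ℂ) →L[ℂ] ℂ :=
  integralMulCLM (hK.measurable_comp_norm (-Complex.I))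
      (hK.integrable_decay hd (by simp) (by simp)) +
    (integralMulCLM measurable_remainder integrable_remainder_decay).comp
      (FourierTransform.fourierInvCLM ℂ 𝓢(EuclideanSpace ℝ (Fin d), ℂ))

lemma distribution_apply (hK : IsResolventKernel d K C) (hd : 1 ≤ d)
    (φ : 𝓢(EuclideanSpace ℝ (Fin d), ℂ)) :
    hK.distribution hd φ = (∫ x, K (-Complex.I) ‖x‖ * φ x) +
      ∫ ξ, (logRemainder (laplaceSymbol ξ) : ℂ) * (𝓕⁻ φ : 𝓢(_, ℂ)) ξ := rfl

lemma distribution_apply_of_norm_le (hK : IsResolventKernel d K C) (hd : d = 1 ∨ d = 2)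
    (φ : 𝓢(EuclideanSpace ℝ (Fin d), ℂ)) {B : EuclideanSpace ℝ (Fin d) → ℝ} (hB : Integrable B)
    (hφ : ∀ ξ, ‖(𝓕⁻ φ : 𝓢(_, ℂ)) ξ‖ ≤ B ξ * |laplaceSymbol ξ - 1|) :
    hK.distribution (by omega) φ =
      ∫ ξ, (((laplaceSymbol ξ : ℂ) - 1)⁻¹ + (logRemainder (laplaceSymbol ξ) : ℂ)) *
        (𝓕⁻ φ : 𝓢(_, ℂ)) ξ := by
  obtain ⟨h1, h2⟩ := hK.integral_eq_of_norm_le hd φ hB hφ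
  rw [distribution_apply, h2, ← integral_add h1
    (integrable_mul_schwartz measurable_remainder integrable_remainder_decay _)]
  simp only [add_mul]

/-- The symbol is even, so the multiplier formula passes from the Fourier transform to its inverse,
which is the one paired with the kernels. -/
lemma fourierInv_logLaplacianLizorkin (φ : lizorkinSpace d) (ξ : EuclideanSpace ℝ (Fin d)) :
    (𝓕⁻ (logLaplacianLizorkin d φ : 𝓢(EuclideanSpace ℝ (Fin d), ℂ)) :
      𝓢(EuclideanSpace ℝ (Fin d), ℂ)) ξ = (Real.log (laplaceSymbol ξ) : ℂ) *
        (𝓕⁻ (φ : 𝓢(EuclideanSpace ℝ (Fin d), ℂ)) : 𝓢(EuclideanSpace ℝ (Fin d), ℂ)) ξ := by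
  have h : ∀ f : 𝓢(EuclideanSpace ℝ (Fin d), ℂ), (𝓕⁻ f : 𝓢(_, ℂ)) ξ = (𝓕 f : 𝓢(_, ℂ)) (-ξ) := by
    intro f
    rw [SchwartzMap.fourierInv_coe, SchwartzMap.fourier_coe, Real.fourierInv_eq_fourier_neg]
  rw [h, h, fourier_logLaplacianLizorkin, ← laplaceSymbol_neg]
  rfl

/-- The zero of the logarithm on the unit sphere cancels the pole, so the distribution acts by
honest integration against `1 / log s`. The logarithms cancel almost everywhere, and the integral of
`𝓕⁻ φ` that remains is `φ 0`. -/
lemma distribution_logLaplacian (hK : IsResolventKernel d K C) (hd : d = 1 ∨ d = 2)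
    (φ : lizorkinSpace d) :
    hK.distribution (by omega) (logLaplacianLizorkin d φ : 𝓢(EuclideanSpace ℝ (Fin d), ℂ)) =
      (φ : 𝓢(EuclideanSpace ℝ (Fin d), ℂ)) 0 := by
  set ψ : 𝓢(EuclideanSpace ℝ (Fin d), ℂ) := 𝓕⁻ (φ : 𝓢(EuclideanSpace ℝ (Fin d), ℂ)) with hψ
  set θ : 𝓢(EuclideanSpace ℝ (Fin d), ℂ) :=
    𝓕⁻ (logLaplacianLizorkin d φ : 𝓢(EuclideanSpace ℝ (Fin d), ℂ)) with hθ
  have hθψ : ∀ ξ, θ ξ = (Real.log (laplaceSymbol ξ) : ℂ) * ψ ξ :=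
    fourierInv_logLaplacianLizorkin φ
  have hnorm : ∀ ξ, ‖θ ξ‖ = |Real.log (laplaceSymbol ξ)| * ‖ψ ξ‖ := fun ξ => by
    rw [hθψ, norm_mul, Complex.norm_real, Real.norm_eq_abs]
  -- The majorant is `abs_log_le_mul_abs_sub_one` multiplied by `‖ψ ξ‖`, with `|log s| ‖ψ ξ‖` read
  -- as `‖θ ξ‖`.
  rw [hK.distribution_apply_of_norm_le hd _
    (B := fun ξ => 3 * ‖ψ ξ‖ + 2 * ‖θ ξ‖)
    ((ψ.integrable.norm.const_mul 3).add (θ.integrable.norm.const_mul 2))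
    (fun ξ => by
      rw [← hθ, hnorm]
      have := mul_le_mul_of_nonneg_right (abs_log_le_mul_abs_sub_one (laplaceSymbol ξ))
        (norm_nonneg (ψ ξ))
      linarith)]
  have hinv : (φ : 𝓢(EuclideanSpace ℝ (Fin d), ℂ)) 0 = ∫ ξ, ψ ξ := by
    have : (φ : 𝓢(EuclideanSpace ℝ (Fin d), ℂ)) = 𝓕 ψ := by
      rw [hψ, FourierTransform.fourier_fourierInv_eq]
    rw [this, SchwartzMap.fourier_coe, Real.fourier_eq]
    simp
  rw [hinv, ← hθ]
  refine integral_congr_ae ?_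
  filter_upwards [ae_laplaceSymbol_ne (by omega)] with ξ hξ
  have hL := Real.log_ne_zero_of_pos_of_ne_one hξ.1 hξ.2
  rw [hθψ, logRemainder_eq hξ.1 hξ.2, ← mul_assoc]
  push_cast
  rw [add_sub_cancel, inv_mul_cancel₀ (by exact_mod_cast hL), one_mul]

end IsResolventKernel

lemma locallyIntegrableOn_of_bounded {d : ℕ} {f : EuclideanSpace ℝ (Fin d) → ℂ}
    (hf : Measurable f) {s : Set (EuclideanSpace ℝ (Fin d))} (hs : MeasurableSet s) {M : ℝ}
    (hM : ∀ x ∈ s, ‖f x‖ ≤ M) : LocallyIntegrableOn f s := by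
  intro x _
  refine ⟨s ∩ Metric.ball x 1, inter_mem_nhdsWithin s (Metric.ball_mem_nhds x one_pos), ?_⟩
  refine Measure.integrableOn_of_bounded (M := M)
    ((measure_mono Set.inter_subset_right).trans_lt measure_ball_lt_top).ne
    hf.aestronglyMeasurable ?_
  filter_upwards [ae_restrict_mem (hs.inter measurableSet_ball)] with y hy
  exact hM y hy.1

/-! ### The Fourier transform near the origin and the decay at infinity -/

namespace IsResolventKernel

variable {d : ℕ} {K : ℂ → ℝ → ℂ} {C : ℝ}

/-- Test functions supported strictly inside the unit sphere do not see the pole, so no vanishing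
condition is needed. This singles out `u` among the extensions of its restriction to the Lizorkin
space. -/
lemma isFunctionOn_fourier (hK : IsResolventKernel d K C) (hd : d = 1 ∨ d = 2)
    {u : 𝓢'(EuclideanSpace ℝ (Fin d), ℂ)} (hu : ∀ φ, u φ = hK.distribution (by omega) φ) :
    IsFunctionOn (𝓕 u)
      (fun ξ => ((laplaceSymbol ξ : ℂ) - 1)⁻¹ + (logRemainder (laplaceSymbol ξ) : ℂ))
      (Metric.ball 0 (4 * Real.pi)⁻¹) := by
  have hpi := Real.pi_pos
  have hm := (continuous_laplaceSymbol (d := d)).measurable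
  have hR := measurable_remainder (d := d)
  -- On this ball `|2πξ| < 1/2`, so the symbol is well below `1`.
  have hball : ∀ ξ ∈ Metric.ball (0 : EuclideanSpace ℝ (Fin d)) (4 * Real.pi)⁻¹,
      1 / 2 ≤ |laplaceSymbol ξ - 1| := by
    intro ξ hξ
    rw [mem_ball_zero_iff] at hξ
    have h1 : 4 * Real.pi * ‖ξ‖ < 1 := by
      have := mul_lt_mul_of_pos_left hξ (by positivity : 0 < 4 * Real.pi)
      rwa [mul_inv_cancel₀ (by positivity)] at this
    have h2 : laplaceSymbol ξ ≤ 1 / 2 := by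
      rw [laplaceSymbol_eq]
      nlinarith [mul_nonneg hpi.le (norm_nonneg ξ)]
    rw [abs_sub_comm]
    exact le_trans (by linarith) (le_abs_self _)
  constructor
  · refine locallyIntegrableOn_of_bounded (M := 2 + 1) (by fun_prop) measurableSet_ball ?_
    intro ξ hξ
    refine (norm_add_le _ _).trans (add_le_add ?_ (norm_remainder_le ξ))
    rw [norm_inv, ← Complex.ofReal_one, ← Complex.ofReal_sub, Complex.norm_real, Real.norm_eq_abs,
      inv_le_comm₀ (by linarith [hball ξ hξ]) two_pos]
    linarith [hball ξ hξ]
  · intro φ _ hsupp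
    have hzero : ∀ ξ ∉ Metric.ball (0 : EuclideanSpace ℝ (Fin d)) (4 * Real.pi)⁻¹, φ ξ = 0 :=
      fun ξ hξ => image_eq_zero_of_notMem_tsupport fun h => hξ (hsupp h)
    rw [TemperedDistribution.fourier_apply, hu]
    have e : 𝓕⁻ (𝓕 φ) = φ := FourierTransform.fourierInv_fourier_eq φ
    rw [hK.distribution_apply_of_norm_le hd _ (B := fun ξ => 2 * ‖φ ξ‖)
      (φ.integrable.norm.const_mul 2) (fun ξ => ?_), e]
    · symm
      apply setIntegral_eq_integral_of_forall_compl_eq_zero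
      intro ξ hξ
      rw [hzero ξ hξ, mul_zero]
    · rw [e]
      by_cases hξ : ξ ∈ Metric.ball (0 : EuclideanSpace ℝ (Fin d)) (4 * Real.pi)⁻¹
      · nlinarith [hball ξ hξ, norm_nonneg (φ ξ)]
      · rw [hzero ξ hξ]; simp

/-- The contribution of the spectral density `1 / (log² t + π²)` to the fundamental solution. -/
noncomputable def remainderKernel (K : ℂ → ℝ → ℂ) (r : ℝ) : ℂ :=
  ∫ t in Set.Ioi (0 : ℝ), ((Real.log t ^ 2 + Real.pi ^ 2)⁻¹ : ℝ) * K (Real.sqrt t : ℂ) r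

lemma measurable_remainderIntegrand (hK : IsResolventKernel d K C) :
    Measurable fun p : ℝ × ℝ =>
      (((Real.log p.2 ^ 2 + Real.pi ^ 2)⁻¹ : ℝ) : ℂ) * K (Real.sqrt p.2 : ℂ) p.1 := by
  apply Measurable.mul
  · fun_prop
  · exact hK.measurable.comp (f := fun p : ℝ × ℝ => ((Real.sqrt p.2 : ℂ), p.1)) (by fun_prop)

lemma measurable_remainderKernel (hK : IsResolventKernel d K C) :
    Measurable (remainderKernel K) :=
  (StronglyMeasurable.integral_prod_right'
    hK.measurable_remainderIntegrand.stronglyMeasurable).measurable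

lemma integrableOn_rpow_mul_exp_sqrt (hd : 1 ≤ d) :
    IntegrableOn (fun t : ℝ => t ^ (-(1 - ((d : ℝ) - 1) / 2) / 2) *
      Real.exp (-2 * t ^ (1 / 2 : ℝ))) (Set.Ioi 0) := by
  have : (1 : ℝ) ≤ d := by exact_mod_cast hd
  exact integrableOn_rpow_mul_exp_neg_mul_rpow (by linarith) (by norm_num) two_pos

/-- The density is at most `1` since `π² ≥ 1`, and `r ≥ 2` allows `e^(-r√t)` to be replaced by
`e^(-2√t)`. The remaining function of `t` does not involve `r`, and its power at `0` is at least
`-1/2`, hence integrable. -/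
lemma norm_remainderIntegrand_le (hK : IsResolventKernel d K C) {r t : ℝ} (hr : 2 ≤ r)
    (ht : 0 < t) :
    ‖(((Real.log t ^ 2 + Real.pi ^ 2)⁻¹ : ℝ) : ℂ) * K (Real.sqrt t : ℂ) r‖ ≤
      r ^ (-(((d : ℝ) - 1) / 2)) * (C * (t ^ (-(1 - ((d : ℝ) - 1) / 2) / 2) *
        Real.exp (-2 * t ^ (1 / 2 : ℝ)))) := by
  have hC := hK.const_nonneg
  have hpi := Real.pi_gt_three
  have hst := Real.sqrt_pos.2 ht
  have h1 : ‖(((Real.log t ^ 2 + Real.pi ^ 2)⁻¹ : ℝ) : ℂ)‖ ≤ 1 := by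
    rw [Complex.norm_real, Real.norm_of_nonneg (by positivity)]
    apply inv_le_one_of_one_le₀
    nlinarith [sq_nonneg (Real.log t)]
  have h2 := hK.norm_le (Real.sqrt t : ℂ) (by simp)
    (by exact_mod_cast hst.ne') r (by linarith)
  rw [Complex.norm_real, Real.norm_of_nonneg hst.le, Complex.ofReal_re] at h2
  rw [norm_mul]
  calc _ ≤ 1 * (C * Real.sqrt t ^ (-(1 - ((d : ℝ) - 1) / 2)) * r ^ (-(((d : ℝ) - 1) / 2)) *
        Real.exp (-(r * Real.sqrt t))) := by gcongr
    _ ≤ 1 * (C * Real.sqrt t ^ (-(1 - ((d : ℝ) - 1) / 2)) * r ^ (-(((d : ℝ) - 1) / 2)) *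
        Real.exp (-2 * Real.sqrt t)) := by
        gcongr
        nlinarith
    _ = _ := by
        rw [Real.sqrt_eq_rpow, ← Real.rpow_mul ht.le,
          show 1 / 2 * -(1 - ((d : ℝ) - 1) / 2) = -(1 - ((d : ℝ) - 1) / 2) / 2 by ring]
        ring

lemma norm_remainderKernel_le (hK : IsResolventKernel d K C) (hd : 1 ≤ d) {r : ℝ} (hr : 2 ≤ r) :
    ‖remainderKernel K r‖ ≤ (∫ t in Set.Ioi (0 : ℝ), C * (t ^ (-(1 - ((d : ℝ) - 1) / 2) / 2) *
      Real.exp (-2 * t ^ (1 / 2 : ℝ)))) * r ^ (-(((d : ℝ) - 1) / 2)) := by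
  rw [mul_comm, ← integral_const_mul]
  refine norm_integral_le_of_norm_le (((integrableOn_rpow_mul_exp_sqrt hd).const_mul C).const_mul
    _) ?_
  filter_upwards [ae_restrict_mem measurableSet_Ioi] with t ht
  exact hK.norm_remainderIntegrand_le hr ht

/-- Fubini is used on both sides of the resolvent identity at `a = √t`. On the Fourier side the unit
mass of the density gives absolute integrability; on the physical side the support in `|x| ≥ 2`
does, through the exponential decay. -/
lemma integral_remainder_eq (hK : IsResolventKernel d K C) (hd : 1 ≤ d)
    (φ : 𝓢(EuclideanSpace ℝ (Fin d), ℂ)) (hφ : ∀ x, ¬ 2 ≤ ‖x‖ → φ x = 0) :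
    Integrable (fun x => remainderKernel K ‖x‖ * φ x) ∧
    ∫ ξ, (logRemainder (laplaceSymbol ξ) : ℂ) * (𝓕⁻ φ : 𝓢(_, ℂ)) ξ =
      ∫ x, remainderKernel K ‖x‖ * φ x := by
  set ψ : 𝓢(EuclideanSpace ℝ (Fin d), ℂ) := 𝓕⁻ φ with hψ
  have hC := hK.const_nonneg
  have hpi := Real.pi_pos
  have hd' : (1 : ℝ) ≤ d := by exact_mod_cast hd
  let w : ℝ → ℝ := fun t => (Real.log t ^ 2 + Real.pi ^ 2)⁻¹
  have hw : Measurable w := by fun_prop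
  let ν : Measure ℝ := volume.restrict (Set.Ioi (0 : ℝ))
  have hm := (continuous_laplaceSymbol (d := d)).measurable
  have hν : ∀ᵐ p : EuclideanSpace ℝ (Fin d) × ℝ ∂(volume.prod ν), 0 < p.2 :=
    Measure.quasiMeasurePreserving_snd.ae (ae_restrict_mem measurableSet_Ioi)
  have hint1 : Integrable (Function.uncurry fun (ξ : EuclideanSpace ℝ (Fin d)) (t : ℝ) =>
      (((t + laplaceSymbol ξ)⁻¹ * w t : ℝ) : ℂ) * ψ ξ) (volume.prod ν) := by
    refine (ψ.integrable.norm.mul_prod (integrableOn_inv_mul_log_sq)).mono' ?_ ?_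
    · have := ψ.continuous.measurable
      apply Measurable.aestronglyMeasurable
      simp only [Function.uncurry_def]
      fun_prop
    · filter_upwards [hν] with p hp
      have hs := laplaceSymbol_nonneg p.1
      simp only [Function.uncurry_def]
      rw [norm_mul, Complex.norm_real, Real.norm_of_nonneg (by positivity), mul_comm]
      gcongr
      linarith
  have hint2 : Integrable (Function.uncurry fun (x : EuclideanSpace ℝ (Fin d)) (t : ℝ) =>
      (w t : ℂ) * K (Real.sqrt t : ℂ) ‖x‖ * φ x) (volume.prod ν) := by
    refine (φ.integrable.norm.mul_prod
      ((integrableOn_rpow_mul_exp_sqrt hd).const_mul C)).mono' ?_ ?_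
    · have h1 := φ.continuous.measurable
      have h2 := hK.measurable_remainderIntegrand.comp
        (f := fun p : EuclideanSpace ℝ (Fin d) × ℝ => (‖p.1‖, p.2)) (by fun_prop)
      exact (h2.mul (h1.comp measurable_fst)).aestronglyMeasurable
    · filter_upwards [hν] with p hp
      simp only [Function.uncurry_def]
      by_cases h : 2 ≤ ‖p.1‖
      · rw [norm_mul, mul_comm]
        gcongr
        refine (hK.norm_remainderIntegrand_le h hp).trans (mul_le_of_le_one_left (by positivity) ?_)
        exact Real.rpow_le_one_of_one_le_of_nonpos (by linarith) (by linarith)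
      · rw [hφ _ h]; simp
  constructor
  · refine hint2.integral_prod_left.congr (Eventually.of_forall fun x => ?_)
    simp only [Function.uncurry_def, remainderKernel]
    exact integral_mul_const _ _
  calc ∫ ξ, (logRemainder (laplaceSymbol ξ) : ℂ) * ψ ξ
      = ∫ ξ, ∫ t, (((t + laplaceSymbol ξ)⁻¹ * w t : ℝ) : ℂ) * ψ ξ ∂ν := by
        refine integral_congr_ae (Eventually.of_forall fun ξ => ?_)
        simp only
        rw [integral_mul_const, integral_complex_ofReal]
        rfl
    _ = ∫ t, ∫ ξ, (((t + laplaceSymbol ξ)⁻¹ * w t : ℝ) : ℂ) * ψ ξ ∂volume ∂ν :=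
        integral_integral_swap hint1
    _ = ∫ t, ∫ x, (w t : ℂ) * K (Real.sqrt t : ℂ) ‖x‖ * φ x ∂volume ∂ν := by
        refine setIntegral_congr_fun measurableSet_Ioi fun t ht => ?_
        have ht : 0 < t := ht
        have h := hK.resolvent (Real.sqrt t : ℂ) (by simpa using ht) φ
        simp only [mul_assoc]
        rw [integral_const_mul, h, ← integral_const_mul]
        refine integral_congr_ae (Eventually.of_forall fun ξ => ?_)
        simp only
        rw [← Complex.ofReal_pow, Real.sq_sqrt ht.le]
        push_cast
        rw [add_comm (t : ℂ)]
        ring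
    _ = ∫ x, ∫ t, (w t : ℂ) * K (Real.sqrt t : ℂ) ‖x‖ * φ x ∂ν :=
        (integral_integral_swap hint2).symm
    _ = _ := by
        refine integral_congr_ae (Eventually.of_forall fun x => ?_)
        simp only
        rw [integral_mul_const]
        rfl

/-- A resolvent kernel yields a fundamental solution of the logarithmic Laplacian. -/
theorem exists_fundamentalSolution (hK : IsResolventKernel d K C) (hd : d = 1 ∨ d = 2) :
    ∃ (E : LizorkinDistribution d) (u : 𝓢'(EuclideanSpace ℝ (Fin d), ℂ))
      (f : EuclideanSpace ℝ (Fin d) → ℂ),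
      IsFundamentalSolution E ∧ IsRepresentative u E ∧ IsFunctionOn u f {x | 2 ≤ ‖x‖} ∧
      (∀ x y, 2 ≤ ‖x‖ → ‖x‖ = ‖y‖ → f x = f y) ∧
      ∃ C : ℝ, ∀ x, 2 ≤ ‖x‖ → ‖f x‖ ≤ C * ‖x‖ ^ (-(((d : ℝ) - 1) / 2)) := by
  have hd1 : 1 ≤ d := by omega
  have hd' : (1 : ℝ) ≤ d := by exact_mod_cast hd1
  have hC := hK.const_nonneg
  let u : 𝓢'(EuclideanSpace ℝ (Fin d), ℂ) :=
    ContinuousLinearMap.toPointwiseConvergenceCLM ℂ (RingHom.id ℂ) _ _ (hK.distribution hd1)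
  have hu : ∀ φ, u φ = hK.distribution hd1 φ := fun φ => rfl
  let f : EuclideanSpace ℝ (Fin d) → ℂ := fun x => K (-Complex.I) ‖x‖ + remainderKernel K ‖x‖
  have hf : Measurable f :=
    (hK.measurable_comp_norm _).add (hK.measurable_remainderKernel.comp measurable_norm)
  set I : ℝ := ∫ t in Set.Ioi (0 : ℝ), C * (t ^ (-(1 - ((d : ℝ) - 1) / 2) / 2) *
      Real.exp (-2 * t ^ (1 / 2 : ℝ))) with hI
  have hI0 : 0 ≤ I := setIntegral_nonneg measurableSet_Ioi fun t ht => by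
    have : 0 < t := ht
    positivity
  have hbound : ∀ x, 2 ≤ ‖x‖ → ‖f x‖ ≤ (C + I) * ‖x‖ ^ (-(((d : ℝ) - 1) / 2)) := by
    intro x hx
    rw [add_mul]
    refine (norm_add_le _ _).trans (add_le_add ?_ (hK.norm_remainderKernel_le hd1 hx))
    have := hK.norm_le (-Complex.I) (by simp) (by simp) ‖x‖ (by linarith)
    simpa using this
  have hset : MeasurableSet {x : EuclideanSpace ℝ (Fin d) | 2 ≤ ‖x‖} :=
    measurableSet_le measurable_const measurable_norm
  -- `E` is the restriction of `u`, so the extension property holds by definition.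
  refine ⟨(hK.distribution hd1).comp (lizorkinSpace d).subtypeL, u, f, ?_, ⟨fun φ => rfl, ?_⟩,
    ⟨?_, ?_⟩, ?_, _, hbound⟩
  · ext φ
    exact hK.distribution_logLaplacian hd φ
  · exact ⟨(4 * Real.pi)⁻¹, by positivity, _, hK.isFunctionOn_fourier hd hu⟩
  · refine locallyIntegrableOn_of_bounded (M := C + I) hf hset fun x hx => ?_
    have hx : 2 ≤ ‖x‖ := hx
    refine (hbound x hx).trans (mul_le_of_le_one_right (by positivity) ?_)
    exact Real.rpow_le_one_of_one_le_of_nonpos (by linarith) (by linarith)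
  · intro φ _ hsupp
    have hzero : ∀ x, ¬ 2 ≤ ‖x‖ → φ x = 0 :=
      fun x hx => image_eq_zero_of_notMem_tsupport fun h => hx (hsupp h)
    obtain ⟨h1, h2⟩ := hK.integral_remainder_eq hd1 φ hzero
    rw [hu, distribution_apply, h2, ← integral_add
      (integrable_mul_schwartz (hK.measurable_comp_norm _)
        (hK.integrable_decay hd1 (by simp) (by simp)) φ) h1,
      setIntegral_eq_integral_of_forall_compl_eq_zero (fun x hx => by
        rw [hzero x hx, mul_zero])]
    simp only [f, add_mul]
  · intro x y _ h
    simp only [f, h]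

end IsResolventKernel

/-- The Fourier transform is symmetric for the bilinear pairing, and `φ` is the transform of `𝓕⁻ φ`.
This reduces a kernel identity to computing the transform of an integrable function. -/
lemma integral_mul_eq_integral_fourier_mul {d : ℕ} {g : EuclideanSpace ℝ (Fin d) → ℂ}
    (hg : Integrable g) (φ : 𝓢(EuclideanSpace ℝ (Fin d), ℂ)) :
    ∫ x, g x * φ x = ∫ ξ, 𝓕 g ξ * (𝓕⁻ φ : 𝓢(_, ℂ)) ξ := by
  have h : ∫ ξ, 𝓕 g ξ • (𝓕⁻ φ : 𝓢(_, ℂ)) ξ = ∫ x, g x • 𝓕 (⇑(𝓕⁻ φ : 𝓢(_, ℂ))) x := by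
    simpa using! VectorFourier.integral_fourierIntegral_smul_eq_flip
      (L := innerₗ (EuclideanSpace ℝ (Fin d))) Real.continuous_fourierChar continuous_inner hg
      (𝓕⁻ φ : 𝓢(_, ℂ)).integrable
  simp only [smul_eq_mul] at h
  rw [h, ← SchwartzMap.fourier_coe, FourierTransform.fourier_fourierInv_eq]

/-! ### The resolvent kernel on the line -/

section DimensionOne

lemma measurePreserving_apply_zero :
    MeasurePreserving (fun x : EuclideanSpace ℝ (Fin 1) => x 0) :=
  (volume_preserving_funUnique (Fin 1) ℝ).comp
    (EuclideanSpace.volume_preserving_symm_measurableEquiv_toLp (Fin 1))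

lemma measurableEmbedding_apply_zero :
    MeasurableEmbedding (fun x : EuclideanSpace ℝ (Fin 1) => x 0) :=
  (MeasurableEquiv.funUnique (Fin 1) ℝ).measurableEmbedding.comp
    (MeasurableEquiv.toLp 2 (Fin 1 → ℝ)).symm.measurableEmbedding

lemma norm_euclideanSpace_one (x : EuclideanSpace ℝ (Fin 1)) : ‖x‖ = |x 0| := by
  simp [EuclideanSpace.norm_eq, Real.sqrt_sq_eq_abs]

lemma exp_abs_pos_part {a : ℂ} (c : ℂ) {y : ℝ} (hy : 0 < y) :
    Complex.exp (c * y) * Complex.exp (-a * (|y| : ℝ)) = Complex.exp ((c - a) * y) := by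
  rw [abs_of_pos hy, ← Complex.exp_add]; congr 1; ring

lemma exp_abs_neg_part {a : ℂ} (c : ℂ) {y : ℝ} (hy : y ≤ 0) :
    Complex.exp (c * y) * Complex.exp (-a * (|y| : ℝ)) = Complex.exp ((c + a) * y) := by
  rw [abs_of_nonpos hy, ← Complex.exp_add]; congr 1; push_cast; ring

lemma integral_exp_mul_exp_abs {a c : ℂ} (hc : c.re = 0) (ha : 0 < a.re) :
    Integrable (fun y : ℝ => Complex.exp (c * y) * Complex.exp (-a * (|y| : ℝ))) ∧
    ∫ y : ℝ, Complex.exp (c * y) * Complex.exp (-a * (|y| : ℝ)) = 2 * a / (a ^ 2 - c ^ 2) := by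
  have hr1 : (c - a).re < 0 := by simp [hc, ha]
  have hr2 : 0 < (c + a).re := by simp [hc, ha]
  have h1 : IntegrableOn (fun y : ℝ => Complex.exp (c * y) * Complex.exp (-a * (|y| : ℝ)))
      (Set.Ioi 0) := by
    refine (integrableOn_congr_fun (fun y hy => exp_abs_pos_part c hy) measurableSet_Ioi).2 ?_
    exact integrableOn_exp_mul_complex_Ioi hr1 0
  have h2 : IntegrableOn (fun y : ℝ => Complex.exp (c * y) * Complex.exp (-a * (|y| : ℝ)))
      (Set.Iic 0) := by
    refine (integrableOn_congr_fun (fun y hy => exp_abs_neg_part c hy) measurableSet_Iic).2 ?_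
    exact integrableOn_exp_mul_complex_Iic hr2 0
  constructor
  · rw [← integrableOn_univ, ← Set.Iic_union_Ioi (a := (0 : ℝ))]
    exact h2.union h1
  · rw [← intervalIntegral.integral_Iic_add_Ioi h2 h1,
      setIntegral_congr_fun measurableSet_Ioi (fun y hy => exp_abs_pos_part c hy),
      setIntegral_congr_fun measurableSet_Iic (fun y hy => exp_abs_neg_part c hy),
      integral_exp_mul_complex_Ioi hr1, integral_exp_mul_complex_Iic hr2]
    have n1 : c - a ≠ 0 := fun h => by rw [h] at hr1; simp at hr1
    have n2 : c + a ≠ 0 := fun h => by rw [h] at hr2; simp at hr2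
    have n3 : a ^ 2 - c ^ 2 ≠ 0 := by
      rw [show a ^ 2 - c ^ 2 = -((c - a) * (c + a)) by ring]
      exact neg_ne_zero.2 (mul_ne_zero n1 n2)
    simp only [Complex.ofReal_zero, mul_zero, Complex.exp_zero]
    field_simp
    ring

/-- The kernel `e^{-a|x|} / (2a)` of `(-Δ + a²)⁻¹` on the line. -/
noncomputable def kernelOne (a : ℂ) (r : ℝ) : ℂ := (2 * a)⁻¹ * Complex.exp (-a * r)

lemma kernelOne_resolvent {a : ℂ} (ha : 0 < a.re) (φ : 𝓢(EuclideanSpace ℝ (Fin 1), ℂ)) :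
    ∫ x, kernelOne a ‖x‖ * φ x =
      ∫ ξ, ((laplaceSymbol ξ : ℂ) + a ^ 2)⁻¹ * (𝓕⁻ φ : 𝓢(_, ℂ)) ξ := by
  have ha0 : a ≠ 0 := fun h => by simp [h] at ha
  have hint : Integrable fun x : EuclideanSpace ℝ (Fin 1) => kernelOne a ‖x‖ := by
    have := ((integral_exp_mul_exp_abs (c := 0) rfl ha).1.const_mul (2 * a)⁻¹)
    have h2 := (measurePreserving_apply_zero.integrable_comp_emb
      measurableEmbedding_apply_zero).2 this
    refine h2.congr (Eventually.of_forall fun x => ?_)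
    simp [kernelOne, norm_euclideanSpace_one]
  rw [integral_mul_eq_integral_fourier_mul hint]
  congr 1
  ext ξ
  congr 1
  rw [Real.fourier_eq']
  have h := (integral_exp_mul_exp_abs (a := a) (c := ((-2 * Real.pi * ξ 0 : ℝ) : ℂ) * Complex.I)
    (by simp) ha).2
  rw [← measurePreserving_apply_zero.integral_comp measurableEmbedding_apply_zero] at h
  have e : ∀ x : EuclideanSpace ℝ (Fin 1),
      Complex.exp (((-2 * Real.pi * inner ℝ x ξ : ℝ) : ℂ) * Complex.I) • kernelOne a ‖x‖ =
      (2 * a)⁻¹ * (Complex.exp (((-2 * Real.pi * ξ 0 : ℝ) : ℂ) * Complex.I * (x 0 : ℝ)) *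
        Complex.exp (-a * (|x 0| : ℝ))) := by
    intro x
    rw [kernelOne, norm_euclideanSpace_one, smul_eq_mul, PiLp.inner_apply]
    simp only [Finset.univ_unique, Fin.default_eq_zero, Finset.sum_singleton]
    rw [mul_left_comm]
    congr 3
    simp
    ring
  simp only [e]
  rw [integral_const_mul, h, laplaceSymbol_eq, norm_euclideanSpace_one, sq_abs]
  rw [show a ^ 2 - (((-2 * Real.pi * ξ 0 : ℝ) : ℂ) * Complex.I) ^ 2 =
    ((4 * Real.pi ^ 2 * ξ 0 ^ 2 : ℝ) : ℂ) + a ^ 2 by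
      push_cast; rw [mul_pow, Complex.I_sq]; ring]
  field_simp

/-- In dimension one the power of `r` is trivial and the norm bound is an equality, with `1 / 2`
from the factor `(2a)⁻¹`. -/
lemma isResolventKernel_kernelOne : IsResolventKernel 1 kernelOne (1 / 2) where
  measurable := by unfold kernelOne; simp only [Function.uncurry_def]; fun_prop
  norm_le a _ ha0 r hr := by
    have : 0 < ‖a‖ := norm_pos_iff.2 ha0
    rw [kernelOne, norm_mul, Complex.norm_exp]
    simp [Real.rpow_neg_one]
    rw [mul_comm r]
    apply le_of_eq; ring
  tendsto r hr := by
    have : ContinuousAt (fun ε : ℝ => kernelOne ((ε : ℂ) - Complex.I) r) 0 := by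
      unfold kernelOne
      fun_prop (disch := simp)
    have := this.tendsto.mono_left (nhdsWithin_le_nhds (s := Set.Ioi 0))
    simpa using this
  resolvent a ha φ := kernelOne_resolvent ha φ

end DimensionOne

/-- A dominated family of holomorphic functions has a holomorphic integral. -/
lemma differentiableAt_integral_of_dominated {α : Type*} [MeasurableSpace α] {μ : Measure α}
    {F : ℂ → α → ℂ} {a₀ : ℂ} {ε : ℝ} (hε : 0 < ε) {bound : α → ℝ}
    (hmeas : ∀ a, AEStronglyMeasurable (F a) μ)
    (hdiff : ∀ᵐ x ∂μ, DifferentiableOn ℂ (fun a => F a x) (Metric.ball a₀ ε))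
    (hbound : ∀ᵐ x ∂μ, ∀ a ∈ Metric.ball a₀ ε, ‖F a x‖ ≤ bound x) (hint : Integrable bound μ) :
    DifferentiableAt ℂ (fun a => ∫ x, F a x ∂μ) a₀ := by
  have hε2 : 0 < ε / 2 := by linarith
  have hd : ∀ᵐ x ∂μ, ∀ a ∈ Metric.ball a₀ (ε / 2),
      HasDerivAt (fun a => F a x) (deriv (fun a => F a x) a) a := by
    filter_upwards [hdiff] with x hx a ha
    exact (hx.differentiableAt (Metric.isOpen_ball.mem_nhds
      (Metric.ball_subset_ball (by linarith) ha))).hasDerivAt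
  -- Around a point within `ε / 2` of `a₀`, the closed disc of radius `ε / 4` stays in the domain;
  -- Cauchy's estimate on it bounds the derivative by `bound / (ε / 4)`.
  refine (hasDerivAt_integral_of_dominated_loc_of_deriv_le (𝕜 := ℂ) (F := F)
    (F' := fun a x => deriv (fun a => F a x) a) (bound := fun x => bound x / (ε / 4))
    (Metric.ball_mem_nhds a₀ hε2) (Eventually.of_forall hmeas)
    (hint.mono' (hmeas a₀) ?_) ?_ ?_ (hint.div_const _) hd).2.differentiableAt
  · filter_upwards [hbound] with x hx
    exact hx a₀ (Metric.mem_ball_self hε)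
  -- The derivative at `a₀` is measurable in `x` as an almost everywhere limit of difference
  -- quotients.
  · refine aestronglyMeasurable_of_tendsto_ae (𝓝[≠] a₀)
      (f := fun a x => slope (fun a => F a x) a₀ a) (fun a => ?_) ?_
    · simp only [slope, vsub_eq_sub]
      exact ((hmeas a).sub (hmeas a₀)).const_smul (a - a₀)⁻¹
    · filter_upwards [hd] with x hx
      exact hasDerivAt_iff_tendsto_slope.1 (hx a₀ (Metric.mem_ball_self hε2))
  · filter_upwards [hdiff, hbound] with x hx hb a ha
    have hsub : Metric.closedBall a (ε / 4) ⊆ Metric.ball a₀ ε := by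
      intro z hz
      rw [Metric.mem_closedBall] at hz
      rw [Metric.mem_ball] at ha ⊢
      linarith [dist_triangle z a a₀]
    refine Complex.norm_deriv_le_of_forall_mem_sphere_norm_le (by linarith) ?_
      fun z hz => hb z (hsub (Metric.sphere_subset_closedBall hz))
    apply DifferentiableOn.diffContOnCl
    rw [closure_ball _ (by linarith)]
    exact hx.mono hsub

/-! ### The resolvent kernel on the plane -/

section DimensionTwo

/-- The substitution `t = (r / 2a) e^v` balances the two terms of the exponent into `a r cosh v`;
evenness in `v` gives the factor `2`. -/
lemma integral_inv_mul_exp_eq_integral_exp_cosh {a r : ℝ} (ha : 0 < a) (hr : 0 < r) :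
    ∫ t in Set.Ioi (0 : ℝ), t⁻¹ * Real.exp (-(a ^ 2 * t) - r ^ 2 / (4 * t)) =
      2 * ∫ v in Set.Ioi (0 : ℝ), Real.exp (-(a * r * Real.cosh v)) := by
  rw [← integral_comp_abs (f := fun v => Real.exp (-(a * r * Real.cosh v))),
    ← integral_exp_smul_comp_exp,
    ← integral_add_right_eq_self _ (Real.log (r / (2 * a)))]
  refine integral_congr_ae (Eventually.of_forall fun v => ?_)
  have hv := Real.exp_pos v
  simp only [Real.cosh_abs]
  rw [Real.exp_add, Real.exp_log (by positivity), smul_eq_mul, ← mul_assoc,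
    mul_inv_cancel₀ (by positivity), one_mul]
  congr 1
  rw [Real.cosh_eq, Real.exp_neg]
  field_simp
  ring

lemma image_cosh_sub_one {a : ℝ} (ha : 0 < a) :
    (fun v => a * (Real.cosh v - 1)) '' Set.Ioi 0 = Set.Ioi 0 := by
  ext q
  constructor
  · rintro ⟨v, hv, rfl⟩
    have hv : 0 < v := hv
    have := Real.one_lt_cosh.2 hv.ne'
    exact mul_pos ha (by linarith)
  · intro hq
    have hq : 0 < q := hq
    have h : 1 < 1 + q / a := by have := div_pos hq ha; linarith
    refine ⟨Real.arcosh (1 + q / a), Real.arcosh_pos h, ?_⟩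
    simp only
    rw [Real.cosh_arcosh h.le]
    field_simp
    ring

/-- With `q = a (cosh v - 1)` one has `q (q + 2a) = (a sinh v)²`, so `dv = dq / √(q (q + 2a))`. The
new form pulls out `e^(-ar)` and keeps a convergence factor independent of `a`, so it still makes
sense for complex `a` up to the imaginary axis. -/
lemma integral_exp_cosh {a r : ℝ} (ha : 0 < a) :
    ∫ v in Set.Ioi (0 : ℝ), Real.exp (-(a * r * Real.cosh v)) =
      Real.exp (-(a * r)) * ∫ q in Set.Ioi (0 : ℝ),
        q ^ (-(1 / 2) : ℝ) * Real.exp (-(r * q)) * (q + 2 * a) ^ (-(1 / 2) : ℝ) := by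
  have h := integral_image_eq_integral_abs_deriv_smul (s := Set.Ioi (0 : ℝ))
    (f := fun v => a * (Real.cosh v - 1)) (f' := fun v => a * Real.sinh v) measurableSet_Ioi
    (fun v _ => (((Real.hasDerivAt_cosh v).sub_const 1).const_mul a).hasDerivWithinAt)
    (fun v hv w hw h => by
      have h' : Real.cosh v = Real.cosh w := by
        have := mul_left_cancel₀ ha.ne' h
        linarith
      exact Real.cosh_strictMonoOn.injOn (Set.Ioi_subset_Ici_self hv)
        (Set.Ioi_subset_Ici_self hw) h')
    (fun q => q ^ (-(1 / 2) : ℝ) * Real.exp (-(r * q)) * (q + 2 * a) ^ (-(1 / 2) : ℝ))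
  rw [image_cosh_sub_one ha] at h
  rw [h, ← integral_const_mul]
  refine setIntegral_congr_fun measurableSet_Ioi fun v hv => ?_
  have hv : 0 < v := hv
  have hs : 0 < Real.sinh v := Real.sinh_pos_iff.2 hv
  have hc := Real.one_lt_cosh.2 hv.ne'
  have h1 : 0 < a * (Real.cosh v - 1) := mul_pos ha (by linarith)
  have h2 : 0 < a * (Real.cosh v - 1) + 2 * a := by linarith
  have h3 : (a * (Real.cosh v - 1)) ^ (-(1 / 2) : ℝ) *
      (a * (Real.cosh v - 1) + 2 * a) ^ (-(1 / 2) : ℝ) = (a * Real.sinh v)⁻¹ := by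
    rw [← Real.mul_rpow h1.le h2.le, Real.rpow_neg (by positivity), ← Real.sqrt_eq_rpow]
    rw [show a * (Real.cosh v - 1) * (a * (Real.cosh v - 1) + 2 * a) = (a * Real.sinh v) ^ 2 by
      rw [mul_pow, Real.sinh_sq]; ring, Real.sqrt_sq (by positivity)]
  simp only [smul_eq_mul]
  rw [abs_of_pos (by positivity), mul_right_comm (_ ^ _), h3,
    mul_inv_cancel_left₀ (by positivity), ← Real.exp_add]
  congr 1
  ring

/-- The kernel of `(-Δ + a²)⁻¹` on the plane, that is `K₀(a|x|) / 2π` in terms of the modified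
Bessel function. -/
noncomputable def kernelTwo (a : ℂ) (r : ℝ) : ℂ :=
  (2 * Real.pi : ℂ)⁻¹ * Complex.exp (-a * r) * ∫ q in Set.Ioi (0 : ℝ),
    ((q ^ (-(1 / 2) : ℝ) * Real.exp (-(r * q)) : ℝ) : ℂ) *
      ((q : ℂ) + 2 * a) ^ ((-(1 / 2) : ℝ) : ℂ)

/-- For real `a > 0` the kernel is the Laplace transform of the planar heat kernel at `a²`, the link
with the Fourier side. -/
lemma kernelTwo_ofReal {a r : ℝ} (ha : 0 < a) (hr : 0 < r) :
    kernelTwo a r = ((∫ t in Set.Ioi (0 : ℝ),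
      (4 * Real.pi * t)⁻¹ * Real.exp (-(a ^ 2 * t) - r ^ 2 / (4 * t)) : ℝ) : ℂ) := by
  have e : ∀ t : ℝ, (4 * Real.pi * t)⁻¹ * Real.exp (-(a ^ 2 * t) - r ^ 2 / (4 * t)) =
      (4 * Real.pi)⁻¹ * (t⁻¹ * Real.exp (-(a ^ 2 * t) - r ^ 2 / (4 * t))) := fun t => by
    rw [mul_inv, mul_assoc]
  simp only [e]
  rw [integral_const_mul, integral_inv_mul_exp_eq_integral_exp_cosh ha hr, integral_exp_cosh ha,
    kernelTwo]
  have h : ∫ q in Set.Ioi (0 : ℝ), ((q ^ (-(1 / 2) : ℝ) * Real.exp (-(r * q)) : ℝ) : ℂ) *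
      ((q : ℂ) + 2 * a) ^ ((-(1 / 2) : ℝ) : ℂ) = ((∫ q in Set.Ioi (0 : ℝ),
        q ^ (-(1 / 2) : ℝ) * Real.exp (-(r * q)) * (q + 2 * a) ^ (-(1 / 2) : ℝ) : ℝ) : ℂ) := by
    rw [← integral_complex_ofReal]
    refine setIntegral_congr_fun measurableSet_Ioi fun q hq => ?_
    have hq : 0 < q := hq
    rw [Complex.ofReal_mul (q ^ (-(1 / 2) : ℝ) * Real.exp (-(r * q))),
      Complex.ofReal_cpow (by positivity : 0 ≤ q + 2 * a)]
    push_cast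
    rfl
  rw [h]
  push_cast
  rw [show -((a : ℂ) * r) = -(a : ℂ) * r by ring]
  field_simp
  ring

lemma measurable_kernelTwo : Measurable (Function.uncurry kernelTwo) := by
  have h : StronglyMeasurable fun p : ℂ × ℝ => ∫ q in Set.Ioi (0 : ℝ),
      ((q ^ (-(1 / 2) : ℝ) * Real.exp (-(p.2 * q)) : ℝ) : ℂ) *
        ((q : ℂ) + 2 * p.1) ^ ((-(1 / 2) : ℝ) : ℂ) := by
    apply StronglyMeasurable.integral_prod_right' (f := fun z : (ℂ × ℝ) × ℝ =>
      ((z.2 ^ (-(1 / 2) : ℝ) * Real.exp (-(z.1.2 * z.2)) : ℝ) : ℂ) *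
        ((z.2 : ℂ) + 2 * z.1.1) ^ ((-(1 / 2) : ℝ) : ℂ))
    apply Measurable.stronglyMeasurable
    fun_prop
  have h' := h.measurable
  simp only [Function.uncurry_def, kernelTwo]
  fun_prop

lemma norm_le_norm_add_two_mul {a : ℂ} (ha : 0 ≤ a.re) {q : ℝ} (hq : 0 < q) :
    ‖a‖ ≤ ‖(q : ℂ) + 2 * a‖ := by
  rw [Complex.norm_eq_sqrt_sq_add_sq, Complex.norm_eq_sqrt_sq_add_sq]
  apply Real.sqrt_le_sqrt
  simp
  nlinarith [sq_nonneg a.im, mul_nonneg ha hq.le, sq_nonneg a.re]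

lemma norm_kernelTwo_integrand_le {a : ℂ} (ha : 0 ≤ a.re) (ha0 : a ≠ 0) {q : ℝ} (hq : 0 < q)
    (r : ℝ) :
    ‖((q ^ (-(1 / 2) : ℝ) * Real.exp (-(r * q)) : ℝ) : ℂ) *
      ((q : ℂ) + 2 * a) ^ ((-(1 / 2) : ℝ) : ℂ)‖ ≤
      ‖a‖ ^ (-(1 / 2) : ℝ) * (q ^ ((1 / 2 : ℝ) - 1) * Real.exp (-(r * q))) := by
  have := norm_pos_iff.2 ha0
  rw [norm_mul, Complex.norm_real, Real.norm_of_nonneg (by positivity), Complex.norm_cpow_real,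
    mul_comm, show (1 / 2 : ℝ) - 1 = -(1 / 2) by norm_num]
  gcongr ?_ * _
  exact Real.rpow_le_rpow_of_nonpos this (norm_le_norm_add_two_mul ha hq) (by norm_num)

/-- Since `|q + 2a| ≥ |a|` for `Re a ≥ 0`, the last factor is at most `|a|^(-1/2)`. What remains is
the Gamma integral `Γ(1/2) r^(-1/2)`, the source of both the constant and the decay. -/
lemma norm_kernelTwo_le {a : ℂ} (ha : 0 ≤ a.re) (ha0 : a ≠ 0) {r : ℝ} (hr : 0 < r) :
    ‖kernelTwo a r‖ ≤ (2 * Real.pi)⁻¹ * Real.Gamma (1 / 2) * ‖a‖ ^ (-(1 / 2) : ℝ) *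
      r ^ (-(1 / 2) : ℝ) * Real.exp (-(r * a.re)) := by
  have hpi := Real.pi_pos
  have h := norm_integral_le_of_norm_le ((integrable_rpow_mul_exp (u := 1 / 2) (by norm_num)
    hr).const_mul (‖a‖ ^ (-(1 / 2) : ℝ))) (by
      filter_upwards [ae_restrict_mem measurableSet_Ioi] with q hq
      exact norm_kernelTwo_integrand_le ha ha0 hq r)
  rw [integral_const_mul, Real.integral_rpow_mul_exp_neg_mul_Ioi (by norm_num) hr, one_div r,
    Real.inv_rpow hr.le, ← Real.rpow_neg hr.le] at h
  rw [kernelTwo, norm_mul, norm_mul, Complex.norm_exp, norm_inv]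
  have e1 : (-a * (r : ℂ)).re = -(r * a.re) := by simp [mul_comm]
  have e2 : ‖(2 * Real.pi : ℂ)‖ = 2 * Real.pi := by
    rw [norm_mul, Complex.norm_real, Real.norm_of_nonneg hpi.le]; simp
  rw [e1, e2]
  calc _ ≤ (2 * Real.pi)⁻¹ * Real.exp (-(r * a.re)) *
        (‖a‖ ^ (-(1 / 2) : ℝ) * (r ^ (-(1 / 2) : ℝ) * Real.Gamma (1 / 2))) := by gcongr
    _ = _ := by ring

lemma tendsto_kernelTwo {r : ℝ} (hr : 0 < r) :
    Tendsto (fun ε : ℝ => kernelTwo ((ε : ℂ) - Complex.I) r) (𝓝[>] 0)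
      (𝓝 (kernelTwo (-Complex.I) r)) := by
  have hlim : Tendsto (fun ε : ℝ => (ε : ℂ) - Complex.I) (𝓝[>] 0) (𝓝 (-Complex.I)) := by
    have : Continuous fun ε : ℝ => (ε : ℂ) - Complex.I := by fun_prop
    simpa using (this.tendsto 0).mono_left (nhdsWithin_le_nhds (s := Set.Ioi 0))
  unfold kernelTwo
  apply Tendsto.mul
  · exact (((hlim.neg.mul_const (r : ℂ)).cexp)).const_mul _
  · refine tendsto_integral_filter_of_dominated_convergence
      (fun q => q ^ ((1 / 2 : ℝ) - 1) * Real.exp (-(r * q))) ?_ ?_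
      (integrable_rpow_mul_exp (by norm_num) hr) ?_
    · refine Eventually.of_forall fun ε => Measurable.aestronglyMeasurable ?_
      fun_prop
    · filter_upwards [self_mem_nhdsWithin] with ε hε
      have hε : 0 < ε := hε
      filter_upwards [ae_restrict_mem measurableSet_Ioi] with q hq
      have hq : 0 < q := hq
      have hn : 1 ≤ ‖(ε : ℂ) - Complex.I‖ := by
        have := Complex.abs_im_le_norm ((ε : ℂ) - Complex.I)
        simpa using this
      refine (norm_kernelTwo_integrand_le (by simpa using hε.le)
        (by rw [← norm_pos_iff]; linarith) hq r).trans (mul_le_of_le_one_left (by positivity) ?_)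
      exact Real.rpow_le_one_of_one_le_of_nonpos hn (by norm_num)
    · filter_upwards [ae_restrict_mem measurableSet_Ioi] with q hq
      have hq : 0 < q := hq
      refine Tendsto.const_mul _ ?_
      -- The limit point `q - 2i` has real part `q > 0`, off the branch cut of the power.
      refine ((hlim.const_mul 2).const_add (q : ℂ)).cpow tendsto_const_nhds (Or.inl ?_)
      simpa using hq

lemma half_re_le_of_mem_ball {a₀ a : ℂ}
    (h : a ∈ Metric.ball a₀ (a₀.re / 2)) : a₀.re / 2 ≤ a.re := by
  have h1 := Complex.abs_re_le_norm (a - a₀)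
  rw [Metric.mem_ball, dist_eq_norm] at h
  rw [Complex.sub_re] at h1
  linarith [(abs_le.1 h1).1]

lemma differentiableAt_kernelTwo {a₀ : ℂ} (ha : 0 < a₀.re) {r : ℝ} (hr : 0 < r) :
    DifferentiableAt ℂ (fun a => kernelTwo a r) a₀ := by
  unfold kernelTwo
  refine DifferentiableAt.mul (by fun_prop) ?_
  refine differentiableAt_integral_of_dominated (ε := a₀.re / 2) (by linarith)
    (bound := fun q => (a₀.re / 2) ^ (-(1 / 2) : ℝ) *
      (q ^ ((1 / 2 : ℝ) - 1) * Real.exp (-(r * q)))) ?_ ?_ ?_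
      ((integrable_rpow_mul_exp (by norm_num) hr).const_mul _)
  · exact fun a => Measurable.aestronglyMeasurable (by fun_prop)
  · filter_upwards [ae_restrict_mem measurableSet_Ioi] with q hq a ha'
    have hq : 0 < q := hq
    have := half_re_le_of_mem_ball ha'
    apply DifferentiableAt.differentiableWithinAt
    refine DifferentiableAt.const_mul ?_ _
    refine DifferentiableAt.cpow (by fun_prop) (by fun_prop) (Or.inl ?_)
    simp
    linarith
  · filter_upwards [ae_restrict_mem measurableSet_Ioi] with q hq a ha'
    have hq : 0 < q := hq
    have h1 := half_re_le_of_mem_ball ha'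
    have h2 : a₀.re / 2 ≤ ‖a‖ := h1.trans (Complex.re_le_norm a)
    refine (norm_kernelTwo_integrand_le (by linarith) (by rw [← norm_pos_iff]; linarith)
      hq r).trans ?_
    gcongr ?_ * _
    exact Real.rpow_le_rpow_of_nonpos (by linarith) h2 (by norm_num)

lemma integrable_norm_rpow_half_mul_schwartz (φ : 𝓢(EuclideanSpace ℝ (Fin 2), ℂ)) :
    Integrable fun x : EuclideanSpace ℝ (Fin 2) =>
      ((‖x‖ ^ (-(1 / 2) : ℝ) : ℝ) : ℂ) * φ x := by
  have e : -((((2 : ℕ) : ℝ) - 1) / 2) = -(1 / 2) := by norm_num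
  have h := integrable_norm_rpow_mul_schwartz (d := 2) (by norm_num) φ
  rwa [e] at h

lemma differentiableAt_integral_kernelTwo {a₀ : ℂ} (ha : 0 < a₀.re)
    (φ : 𝓢(EuclideanSpace ℝ (Fin 2), ℂ)) :
    DifferentiableAt ℂ (fun a => ∫ x, kernelTwo a ‖x‖ * φ x) a₀ := by
  have hpos : ∀ᵐ x : EuclideanSpace ℝ (Fin 2), 0 < ‖x‖ :=
    IsResolventKernel.ae_norm_pos (by norm_num)
  let G : EuclideanSpace ℝ (Fin 2) → ℂ := fun x => ((‖x‖ ^ (-(1 / 2) : ℝ) : ℝ) : ℂ)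
  have hG : Integrable fun x => G x * φ x := integrable_norm_rpow_half_mul_schwartz φ
  refine differentiableAt_integral_of_dominated (ε := a₀.re / 2) (by linarith)
    (bound := fun x => (2 * Real.pi)⁻¹ * Real.Gamma (1 / 2) * (a₀.re / 2) ^ (-(1 / 2) : ℝ) *
      ‖G x * φ x‖) ?_ ?_ ?_ (hG.norm.const_mul _)
  · intro a
    exact (measurable_kernelTwo.comp
      (measurable_const.prodMk measurable_norm)).aestronglyMeasurable.mul
      φ.continuous.aestronglyMeasurable
  · filter_upwards [hpos] with x hx a ha'
    have := half_re_le_of_mem_ball ha'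
    exact ((differentiableAt_kernelTwo (by linarith) hx).mul_const _).differentiableWithinAt
  · filter_upwards [hpos] with x hx a ha'
    have h1 := half_re_le_of_mem_ball ha'
    have h2 : a₀.re / 2 ≤ ‖a‖ := h1.trans (Complex.re_le_norm a)
    have hpi := Real.pi_pos
    rw [norm_mul, norm_mul, ← mul_assoc]
    gcongr ?_ * _
    refine (norm_kernelTwo_le (by linarith) (by rw [← norm_pos_iff]; linarith) hx).trans ?_
    simp only [G, Complex.norm_real]
    rw [Real.norm_of_nonneg (by positivity)]
    have h3 : Real.exp (-(‖x‖ * a.re)) ≤ 1 := Real.exp_le_one_iff.2 (by nlinarith)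
    refine (mul_le_of_le_one_right (by positivity) h3).trans ?_
    gcongr ?_ * _
    gcongr _ * ?_
    exact Real.rpow_le_rpow_of_nonpos (by linarith) h2 (by norm_num)

/-- The factors `a ± i√s` of `s + a²` both have real part `Re a`. -/
lemma sq_re_le_norm_add_sq {a : ℂ} (ha : 0 ≤ a.re) {s : ℝ} (hs : 0 ≤ s) :
    a.re ^ 2 ≤ ‖(s : ℂ) + a ^ 2‖ := by
  have e : (s : ℂ) + a ^ 2 = (a + Complex.I * (Real.sqrt s : ℂ)) *
      (a - Complex.I * (Real.sqrt s : ℂ)) := by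
    have : (Real.sqrt s : ℂ) ^ 2 = s := by rw [← Complex.ofReal_pow, Real.sq_sqrt hs]
    linear_combination (-1 : ℂ) * this + (Real.sqrt s : ℂ) ^ 2 * Complex.I_sq
  have h1 := Complex.re_le_norm (a + Complex.I * (Real.sqrt s : ℂ))
  have h2 := Complex.re_le_norm (a - Complex.I * (Real.sqrt s : ℂ))
  simp at h1 h2
  rw [e, norm_mul, sq]
  gcongr

lemma differentiableAt_integral_symbol {d : ℕ} {a₀ : ℂ} (ha : 0 < a₀.re)
    (ψ : 𝓢(EuclideanSpace ℝ (Fin d), ℂ)) :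
    DifferentiableAt ℂ (fun a => ∫ ξ, ((laplaceSymbol ξ : ℂ) + a ^ 2)⁻¹ * ψ ξ) a₀ := by
  have hm := (continuous_laplaceSymbol (d := d)).measurable
  have hne : ∀ a ∈ Metric.ball a₀ (a₀.re / 2), ∀ ξ : EuclideanSpace ℝ (Fin d),
      (a₀.re / 2) ^ 2 ≤ ‖(laplaceSymbol ξ : ℂ) + a ^ 2‖ := by
    intro a ha' ξ
    have h1 := half_re_le_of_mem_ball ha'
    refine le_trans ?_ (sq_re_le_norm_add_sq (by linarith) (laplaceSymbol_nonneg ξ))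
    gcongr
  have hp : 0 < (a₀.re / 2) ^ 2 := by positivity
  refine differentiableAt_integral_of_dominated (ε := a₀.re / 2) (by linarith)
    (bound := fun ξ => ((a₀.re / 2) ^ 2)⁻¹ * ‖ψ ξ‖) ?_ ?_ ?_ (ψ.integrable.norm.const_mul _)
  · intro a
    exact (by fun_prop : Measurable fun ξ : EuclideanSpace ℝ (Fin d) =>
      ((laplaceSymbol ξ : ℂ) + a ^ 2)⁻¹).aestronglyMeasurable.mul
        ψ.continuous.aestronglyMeasurable
  · refine Eventually.of_forall fun ξ a ha' => DifferentiableAt.differentiableWithinAt ?_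
    refine DifferentiableAt.mul_const (DifferentiableAt.inv (by fun_prop) ?_) _
    rw [← norm_pos_iff]
    exact hp.trans_le (hne a ha' ξ)
  · refine Eventually.of_forall fun ξ a ha' => ?_
    rw [norm_mul, norm_inv]
    gcongr
    exact hne a ha' ξ

lemma integral_gaussian_symbol {t : ℝ} (ht : 0 < t) (φ : 𝓢(EuclideanSpace ℝ (Fin 2), ℂ)) :
    ∫ ξ, (Real.exp (-(t * laplaceSymbol ξ)) : ℂ) * (𝓕⁻ φ : 𝓢(_, ℂ)) ξ =
      ∫ x, (((4 * Real.pi * t)⁻¹ * Real.exp (-(‖x‖ ^ 2 / (4 * t))) : ℝ) : ℂ) * φ x := by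
  have hpi := Real.pi_pos
  have hb : 0 < (((4 * t)⁻¹ : ℝ) : ℂ).re := by rw [Complex.ofReal_re]; positivity
  have hint : Integrable fun x : EuclideanSpace ℝ (Fin 2) =>
      Complex.exp (-(((4 * t)⁻¹ : ℝ) : ℂ) * (‖x‖ : ℂ) ^ 2) := by
    have := GaussianFourier.integrable_cexp_neg_mul_sq_norm_add (V := EuclideanSpace ℝ (Fin 2))
      hb 0 0
    simpa using this
  have h := integral_mul_eq_integral_fourier_mul hint φ
  have hF : ∀ ξ : EuclideanSpace ℝ (Fin 2), 𝓕 (fun x : EuclideanSpace ℝ (Fin 2) =>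
      Complex.exp (-(((4 * t)⁻¹ : ℝ) : ℂ) * (‖x‖ : ℂ) ^ 2)) ξ =
        ((4 * Real.pi * t : ℝ) : ℂ) * (Real.exp (-(t * laplaceSymbol ξ)) : ℂ) := by
    intro ξ
    rw [fourier_gaussian_innerProductSpace hb, finrank_euclideanSpace_fin, laplaceSymbol_eq]
    -- The Gaussian prefactor is a power `d / 2`, which is `1` on the plane.
    have e1 : (((2 : ℕ) : ℂ) / 2) = 1 := by norm_num
    rw [e1, Complex.cpow_one]
    have ht' : (t : ℂ) ≠ 0 := by exact_mod_cast ht.ne'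
    congr 1
    · push_cast; field_simp
    · push_cast; congr 1; field_simp
  simp only [hF, mul_assoc ((4 * Real.pi * t : ℝ) : ℂ)] at h
  rw [integral_const_mul] at h
  have hne : ((4 * Real.pi * t : ℝ) : ℂ) ≠ 0 := by
    exact_mod_cast (by positivity : 4 * Real.pi * t ≠ 0)
  refine mul_left_cancel₀ hne ?_
  rw [← h, ← integral_const_mul]
  refine integral_congr_ae (Eventually.of_forall fun x => ?_)
  simp only
  rw [← mul_assoc, Complex.ofReal_mul (4 * Real.pi * t)⁻¹, Complex.ofReal_inv (4 * Real.pi * t),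
    mul_inv_cancel_left₀ hne]
  push_cast
  congr 2
  have ht' : (t : ℂ) ≠ 0 := by exact_mod_cast ht.ne'
  field_simp

/-- From `y^(1/4) ≤ 1 + y ≤ e^y` at `y = r² / (4t)`. The bound trades the non-integrable `t⁻¹` for
`t^(-3/4)` at the cost of `r^(-1/2)`, so it is integrable separately in time and, against a Schwartz
function, in space, as Fubini requires. -/
lemma heat_kernel_le {r t : ℝ} (hr : 0 < r) (ht : 0 < t) :
    (4 * Real.pi * t)⁻¹ * Real.exp (-(r ^ 2 / (4 * t))) ≤
      r ^ (-(1 / 2) : ℝ) * t ^ ((1 / 4 : ℝ) - 1) := by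
  have hpi := Real.pi_gt_three
  have hy : 0 < r ^ 2 / (4 * t) := by positivity
  have h1 : Real.exp (-(r ^ 2 / (4 * t))) ≤ (r ^ 2 / (4 * t)) ^ (-(1 / 4) : ℝ) := by
    rw [Real.exp_neg, Real.rpow_neg hy.le]
    gcongr
    have h2 : (r ^ 2 / (4 * t)) ^ (1 / 4 : ℝ) ≤ (1 + r ^ 2 / (4 * t)) ^ (1 / 4 : ℝ) := by
      gcongr; linarith
    have h3 : (1 + r ^ 2 / (4 * t)) ^ (1 / 4 : ℝ) ≤ 1 + r ^ 2 / (4 * t) := by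
      conv_rhs => rw [← Real.rpow_one (1 + r ^ 2 / (4 * t))]
      exact Real.rpow_le_rpow_of_exponent_le (by linarith) (by norm_num)
    linarith [Real.add_one_le_exp (r ^ 2 / (4 * t))]
  have h4 : (r ^ 2 / (4 * t)) ^ (-(1 / 4) : ℝ) =
      4 ^ (1 / 4 : ℝ) * (r ^ (-(1 / 2) : ℝ) * t ^ (1 / 4 : ℝ)) := by
    rw [Real.div_rpow (by positivity) (by positivity), Real.mul_rpow (by norm_num) ht.le,
      ← Real.rpow_natCast, ← Real.rpow_mul hr.le, Real.rpow_neg (by norm_num : (0 : ℝ) ≤ 4),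
      Real.rpow_neg ht.le]
    have e : ((2 : ℕ) : ℝ) * -(1 / 4) = -(1 / 2) := by norm_num
    rw [e]
    field_simp
  have h5 : (4 : ℝ) ^ (1 / 4 : ℝ) ≤ 4 := by
    conv_rhs => rw [← Real.rpow_one (4 : ℝ)]
    exact Real.rpow_le_rpow_of_exponent_le (by norm_num) (by norm_num)
  have h6 : (4 * Real.pi * t)⁻¹ ≤ (4 * t)⁻¹ := by
    gcongr
    nlinarith
  calc _ ≤ (4 * t)⁻¹ * (4 * (r ^ (-(1 / 2) : ℝ) * t ^ (1 / 4 : ℝ))) := by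
        rw [h4] at h1
        have h7 : 0 ≤ r ^ (-(1 / 2) : ℝ) * t ^ (1 / 4 : ℝ) := by positivity
        exact mul_le_mul h6 (h1.trans (mul_le_mul_of_nonneg_right h5 h7)) (by positivity)
          (by positivity)
    _ = _ := by
        rw [Real.rpow_sub_one ht.ne']
        field_simp

/-- The resolvent is the Laplace transform `∫ e^(-a²t) e^(-ts) dt` of the heat semigroup: the
Gaussian identity is applied for each `t`, with an exchange of integrals before and after. -/
lemma kernelTwo_resolvent_ofReal {a : ℝ} (ha : 0 < a) (φ : 𝓢(EuclideanSpace ℝ (Fin 2), ℂ)) :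
    ∫ x, kernelTwo a ‖x‖ * φ x =
      ∫ ξ, ((laplaceSymbol ξ : ℂ) + (a : ℂ) ^ 2)⁻¹ * (𝓕⁻ φ : 𝓢(_, ℂ)) ξ := by
  set ψ : 𝓢(EuclideanSpace ℝ (Fin 2), ℂ) := 𝓕⁻ φ with hψ
  have hpi := Real.pi_pos
  have ha2 : 0 < a ^ 2 := by positivity
  let ν : Measure ℝ := volume.restrict (Set.Ioi (0 : ℝ))
  have hm := (continuous_laplaceSymbol (d := 2)).measurable
  have hν : ∀ᵐ p : EuclideanSpace ℝ (Fin 2) × ℝ ∂(volume.prod ν), 0 < p.2 :=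
    Measure.quasiMeasurePreserving_snd.ae (ae_restrict_mem measurableSet_Ioi)
  have hpos : ∀ᵐ x : EuclideanSpace ℝ (Fin 2), 0 < ‖x‖ :=
    IsResolventKernel.ae_norm_pos (by norm_num)
  have hpos' : ∀ᵐ p : EuclideanSpace ℝ (Fin 2) × ℝ ∂(volume.prod ν), 0 < ‖p.1‖ :=
    Measure.quasiMeasurePreserving_fst.ae hpos
  have hexp : IntegrableOn (fun t : ℝ => Real.exp (-(a ^ 2 * t))) (Set.Ioi 0) := by
    simpa using integrable_rpow_mul_exp (u := 1) one_pos ha2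
  have hint1 : Integrable (Function.uncurry fun (ξ : EuclideanSpace ℝ (Fin 2)) (t : ℝ) =>
      (Real.exp (-(a ^ 2 * t)) : ℂ) * ((Real.exp (-(t * laplaceSymbol ξ)) : ℂ) * ψ ξ))
      (volume.prod ν) := by
    refine (ψ.integrable.norm.mul_prod hexp).mono' ?_ ?_
    · have := ψ.continuous.measurable
      apply Measurable.aestronglyMeasurable
      simp only [Function.uncurry_def]
      fun_prop
    · filter_upwards [hν] with p hp
      have hs := laplaceSymbol_nonneg p.1
      simp only [Function.uncurry_def]
      rw [norm_mul, norm_mul, Complex.norm_real, Complex.norm_real,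
        Real.norm_of_nonneg (Real.exp_pos _).le, Real.norm_of_nonneg (Real.exp_pos _).le, mul_comm]
      gcongr
      exact mul_le_of_le_one_left (norm_nonneg _) (Real.exp_le_one_iff.2 (by nlinarith))
  let G : EuclideanSpace ℝ (Fin 2) → ℂ := fun x => ((‖x‖ ^ (-(1 / 2) : ℝ) : ℝ) : ℂ)
  have hG : Integrable fun x => G x * φ x := integrable_norm_rpow_half_mul_schwartz φ
  have hint2 : Integrable (Function.uncurry fun (x : EuclideanSpace ℝ (Fin 2)) (t : ℝ) =>
      (Real.exp (-(a ^ 2 * t)) : ℂ) *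
        ((((4 * Real.pi * t)⁻¹ * Real.exp (-(‖x‖ ^ 2 / (4 * t))) : ℝ) : ℂ) * φ x))
      (volume.prod ν) := by
    refine (hG.norm.mul_prod (integrable_rpow_mul_exp (u := 1 / 4) (by norm_num) ha2)).mono' ?_ ?_
    · have := φ.continuous.measurable
      apply Measurable.aestronglyMeasurable
      simp only [Function.uncurry_def]
      fun_prop
    · filter_upwards [hν, hpos'] with p hp hp'
      simp only [Function.uncurry_def, G]
      rw [norm_mul, norm_mul, norm_mul, Complex.norm_real, Complex.norm_real, Complex.norm_real,
        Real.norm_of_nonneg (Real.exp_pos _).le, Real.norm_of_nonneg (by positivity),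
        Real.norm_of_nonneg (by positivity)]
      have := heat_kernel_le hp' hp
      calc _ ≤ Real.exp (-(a ^ 2 * p.2)) *
            ((‖p.1‖ ^ (-(1 / 2) : ℝ) * p.2 ^ ((1 / 4 : ℝ) - 1)) * ‖φ p.1‖) := by gcongr
        _ = _ := by ring
  symm
  calc ∫ ξ, ((laplaceSymbol ξ : ℂ) + (a : ℂ) ^ 2)⁻¹ * ψ ξ
      = ∫ ξ, ∫ t, (Real.exp (-(a ^ 2 * t)) : ℂ) *
          ((Real.exp (-(t * laplaceSymbol ξ)) : ℂ) * ψ ξ) ∂ν := by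
        refine integral_congr_ae (Eventually.of_forall fun ξ => ?_)
        have hs := laplaceSymbol_nonneg ξ
        have h := Real.integral_rpow_mul_exp_neg_mul_Ioi (a := 1) (r := laplaceSymbol ξ + a ^ 2)
          one_pos (by positivity)
        simp only [sub_self, Real.rpow_zero, one_mul, Real.rpow_one, Real.Gamma_one, mul_one,
          one_div] at h
        simp only [← mul_assoc]
        rw [integral_mul_const]
        congr 1
        rw [← Complex.ofReal_pow, ← Complex.ofReal_add, ← Complex.ofReal_inv, ← h,
          ← integral_complex_ofReal]
        refine integral_congr_ae (Eventually.of_forall fun t => ?_)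
        simp only
        rw [← Complex.ofReal_mul, ← Real.exp_add]
        congr 2
        ring
    _ = ∫ t, ∫ ξ, (Real.exp (-(a ^ 2 * t)) : ℂ) *
          ((Real.exp (-(t * laplaceSymbol ξ)) : ℂ) * ψ ξ) ∂volume ∂ν :=
        integral_integral_swap hint1
    _ = ∫ t, ∫ x, (Real.exp (-(a ^ 2 * t)) : ℂ) *
        ((((4 * Real.pi * t)⁻¹ * Real.exp (-(‖x‖ ^ 2 / (4 * t))) : ℝ) : ℂ) * φ x)
          ∂volume ∂ν := by
        refine setIntegral_congr_fun measurableSet_Ioi fun t ht => ?_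
        rw [integral_const_mul, integral_const_mul, integral_gaussian_symbol ht φ]
    _ = ∫ x, ∫ t, (Real.exp (-(a ^ 2 * t)) : ℂ) *
        ((((4 * Real.pi * t)⁻¹ * Real.exp (-(‖x‖ ^ 2 / (4 * t))) : ℝ) : ℂ) * φ x) ∂ν :=
        (integral_integral_swap hint2).symm
    _ = _ := by
        refine integral_congr_ae ?_
        filter_upwards [hpos] with x hx
        simp only [← mul_assoc]
        rw [integral_mul_const, kernelTwo_ofReal ha hx, ← integral_complex_ofReal]
        congr 1
        refine integral_congr_ae (Eventually.of_forall fun t => ?_)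
        simp only
        rw [← Complex.ofReal_mul, mul_left_comm, ← Real.exp_add]
        rfl

/-- Both sides are holomorphic in the half-plane `Re a > 0` and agree on the positive reals, so the
identity theorem applies. -/
lemma kernelTwo_resolvent {a : ℂ} (ha : 0 < a.re) (φ : 𝓢(EuclideanSpace ℝ (Fin 2), ℂ)) :
    ∫ x, kernelTwo a ‖x‖ * φ x =
      ∫ ξ, ((laplaceSymbol ξ : ℂ) + a ^ 2)⁻¹ * (𝓕⁻ φ : 𝓢(_, ℂ)) ξ := by
  have hopen : IsOpen {z : ℂ | 0 < z.re} := isOpen_lt continuous_const Complex.continuous_re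
  have hA : AnalyticOnNhd ℂ (fun a => ∫ x, kernelTwo a ‖x‖ * φ x) {z : ℂ | 0 < z.re} :=
    DifferentiableOn.analyticOnNhd
      (fun z hz => (differentiableAt_integral_kernelTwo hz φ).differentiableWithinAt) hopen
  have hB : AnalyticOnNhd ℂ (fun a => ∫ ξ, ((laplaceSymbol ξ : ℂ) + a ^ 2)⁻¹ *
      (𝓕⁻ φ : 𝓢(_, ℂ)) ξ) {z : ℂ | 0 < z.re} :=
    DifferentiableOn.analyticOnNhd
      (fun z hz => (differentiableAt_integral_symbol hz _).differentiableWithinAt) hopen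
  refine hA.eqOn_of_preconnected_of_frequently_eq hB
    (convex_halfSpace_re_gt 0).isPreconnected (z₀ := 1) (by simp) ?_ ha
  -- Real points accumulate at `1` within the punctured complex neighbourhood.
  have ht : Tendsto (fun x : ℝ => (x : ℂ)) (𝓝[≠] 1) (𝓝[≠] 1) := by
    refine tendsto_nhdsWithin_of_tendsto_nhds_of_eventually_within _ ?_ ?_
    · exact_mod_cast (Complex.continuous_ofReal.tendsto 1).mono_left nhdsWithin_le_nhds
    · filter_upwards [self_mem_nhdsWithin] with x hx
      simpa using hx
  refine ht.frequently (Eventually.frequently ?_)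
  filter_upwards [nhdsWithin_le_nhds (Ioi_mem_nhds (zero_lt_one (α := ℝ)))] with x hx
  exact kernelTwo_resolvent_ofReal hx φ

lemma isResolventKernel_kernelTwo :
    IsResolventKernel 2 kernelTwo ((2 * Real.pi)⁻¹ * Real.Gamma (1 / 2)) where
  measurable := measurable_kernelTwo
  norm_le a ha ha0 r hr := by
    have h := norm_kernelTwo_le ha ha0 hr
    have e1 : -(1 - (((2 : ℕ) : ℝ) - 1) / 2) = -(1 / 2) := by norm_num
    have e2 : -((((2 : ℕ) : ℝ) - 1) / 2) = -(1 / 2) := by norm_num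
    rw [e1, e2]
    exact h
  tendsto r hr := tendsto_kernelTwo hr
  resolvent a ha φ := kernelTwo_resolvent ha φ

end DimensionTwo

end LogLap

/-! ### The two dimensions -/

theorem theorem3 (d : ℕ) (hd : d = 1 ∨ d = 2) :
    ∃ (E : LogLap.LizorkinDistribution d) (u : 𝓢'(EuclideanSpace ℝ (Fin d), ℂ))
      (f : EuclideanSpace ℝ (Fin d) → ℂ),
      LogLap.IsFundamentalSolution E ∧
      LogLap.IsRepresentative u E ∧
      LogLap.IsFunctionOn u f {x | 2 ≤ ‖x‖} ∧
      (∀ x y, 2 ≤ ‖x‖ → ‖x‖ = ‖y‖ → f x = f y) ∧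
      ∃ C : ℝ, ∀ x, 2 ≤ ‖x‖ → ‖f x‖ ≤ C * ‖x‖ ^ (-(((d : ℝ) - 1) / 2)) := by
  rcases hd with rfl | rfl
  · exact LogLap.isResolventKernel_kernelOne.exists_fundamentalSolution (Or.inl rfl)
  · exact LogLap.isResolventKernel_kernelTwo.exists_fundamentalSolution (Or.inr rfl)
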